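/- **Setting.** Consider the master system $$\dot x=Ax+\varphi_0(y)+b\,\varphi(y)^T\theta,\qquad y=c^Tx,\qquad x(t)\in\mathbb R^n,\ \theta\in\mathbb R^m,$$ where $\varphi_0:\mathbb R\to\mathbb R^n$ and $\varphi:\mathbb R\to\mathbb R^m$ are bounded on bounded sets, $\varphi$ is continuous, and for every $\theta$ every trajectory $x$ on $[0,\infty)$ is bounded. Let $k\in\mathbb R^n$ be such that $F=A-kc^T$ is Hurwitz, let $H(p)=c^T(pI-F)^{-1}b\neq0$ have relative degree $r$, let $\lambda>0$ and $W(p)=(p+\lambda)H(p)$. For signals on $[0,\infty)$ write $v=W(p)[u]$ if $\dot z=Fz+bu$ and $v=c^T(F+\lambda I)z+c^Tb\,u$ for some filter state $z$ with arbitrary initial value (this is a realization of $W$), and write $u=W(p)^{-1}[v]$ if $v=W(p)[u]$. The closed loop consists of the master system, the observer $$\dot{\hat x}=A\hat x+\varphi_0(y)+b\,\nu+k(y-\hat y),\qquad \hat y=c^T\hat x,$$ the regressor $\varpi_i=W(p)[\varphi_i(y)]$, the feedback $\nu=W(p)^{-1}[\varpi^T\hat\theta]$, and, with $e=y-\hat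 y$, the high-order tuner $$\dot\psi_i=\varpi_i e,\qquad \dot\eta_i=(1+\mu\varpi^T\varpi)(\Gamma\eta_i+h\psi_i),\qquad \hat\theta_i=l^T\eta_i\qquad(i=1,\dots,m),$$ where $(l,\Gamma,h)$ is a minimal realization of $\alpha(0)/\alpha(p)=l^T(pI-\Gamma)^{-1}h$ for a Hurwitz polynomial $\alpha$ of degree $r-2$. If $r\le2$, the filters $\eta_i$ are omitted and $\hat\theta=\psi$, i.e. $\dot{\hat\theta}=\varpi e$. $H$ is called minimum phase if all its zeros have negative real part. A function $f:[0,\infty)\to\mathbb R^m$ is persistently exciting if it is measurable and bounded and there are $a,T>0$ with $\int_t^{t+T}f(s)f(s)^Tds\ge aI$ for all $t\ge0$. **Theorem 2.** (i) Let $P$ be the positive definite matrix with $\Gamma^TP+P\Gamma=-2I$ and let $$\mu>\frac{3}{4\lambda}\bigl(|l|+|P\Gamma^{-1}h|\bigr)^2$$ (for $r\le2$ this condition is only $\mu>0$, and $\mu$ plays no role). Then, for any initial conditions, along every trajectory of the closed loop on $[0,\infty)$ the signals $x$, $y$, $\varphi_0(y)$, $\varphi(y)$, $\hat y$, $\varpi$,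 the states of the filters generating $\varpi$, and $\psi_i$, $\eta_i$, $\hat\theta$ are bounded, and $y(t)-\hat y(t)\to0$ as $t\to\infty$. If $H$ is minimum phase (so that the filter $W(p)^{-1}$ is stable), the remaining signals, namely $\nu$, the state of the filter defining $W(p)^{-1}$, and $\hat x$, are bounded too. (ii) If in addition $t\mapsto\varphi(y(t))$ is persistently exciting and $H$ is minimum phase, then $|\theta-\hat\theta(t)|\to0$ as $t\to\infty$. -/

import Mathlib

open Filter Topology Matrix

noncomputable section

namespace HOT

/-- A real polynomial is Hurwitz if it is nonzero and all its complex roots have negative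
real part. -/
def HurwitzPoly (a : Polynomial ℝ) : Prop :=
  a ≠ 0 ∧ ∀ z : ℂ, Polynomial.aeval z a = 0 → z.re < 0

/-- A real square matrix is Hurwitz if all its eigenvalues have negative real part. -/
def HurwitzMatrix {n : ℕ} (F : Matrix (Fin n) (Fin n) ℝ) : Prop :=
  HurwitzPoly F.charpoly

/-- The transfer function `gᵀ (p I - F)⁻¹ b + d` as a rational function of `p`. -/
def transferFn {n : ℕ} (F : Matrix (Fin n) (Fin n) ℝ) (b g : Fin n → ℝ) (d : ℝ) : RatFunc ℝ :=
  (fun i => RatFunc.C (g i)) ⬝ᵥ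
      (((RatFunc.X : RatFunc ℝ) • (1 : Matrix (Fin n) (Fin n) (RatFunc ℝ)) -
          F.map RatFunc.C)⁻¹ *ᵥ fun i => RatFunc.C (b i)) +
    RatFunc.C d

/-- The nonzero transfer function `H` has relative degree `r`
(degree of the denominator minus degree of the numerator). -/
def HasRelativeDegree (H : RatFunc ℝ) (r : ℕ) : Prop :=
  H ≠ 0 ∧ H.intDegree = -(r : ℤ)

/-- All (finite) zeros of `H` lie in the open left half-plane. -/
def MinimumPhase (H : RatFunc ℝ) : Prop :=
  HurwitzPoly H.num

/-- Boundedness of a signal on `[0, ∞)`. -/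
def BoundedSignal {E : Type*} [Norm E] (f : ℝ → E) : Prop :=
  ∃ C : ℝ, ∀ t : ℝ, 0 ≤ t → ‖f t‖ ≤ C

/-- Persistent excitation on `[0, ∞)`: `f` is measurable and bounded there and
`∫_t^{t+T} f(s) f(s)ᵀ ds ≥ α I` for some `α, T > 0` and all `t ≥ 0`. -/
def PersistentlyExciting {m : ℕ} (f : ℝ → Fin m → ℝ) : Prop :=
  Measurable (fun t : Set.Ici (0 : ℝ) => f t) ∧ BoundedSignal f ∧
    ∃ α > (0 : ℝ), ∃ T > (0 : ℝ), ∀ t : ℝ, 0 ≤ t →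
      (Matrix.of (fun i j : Fin m => ∫ s in t..(t + T), f s i * f s j) -
        α • (1 : Matrix (Fin m) (Fin m) ℝ)).PosSemidef

/-- `v` is an output, for the input `u`, of the filter with transfer function
`gᵀ (p I - F)⁻¹ b + d`, and `z` is the corresponding state; the initial state is arbitrary. -/
structure FilterResponse {n : ℕ} (F : Matrix (Fin n) (Fin n) ℝ) (b g : Fin n → ℝ) (d : ℝ)
    (u : ℝ → ℝ) (z : ℝ → Fin n → ℝ) (v : ℝ → ℝ) : Prop where
  state : ∀ t : ℝ, 0 ≤ t → HasDerivWithinAt z (F *ᵥ z t + u t • b) (Set.Ici 0) t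
  output : ∀ t : ℝ, 0 ≤ t → v t = g ⬝ᵥ z t + d * u t

/-- Data of the master system `x' = A x + φ₀(y) + b φ(y)ᵀ θ`, `y = cᵀ x`. -/
structure Plant (n m : ℕ) where
  A : Matrix (Fin n) (Fin n) ℝ
  b : Fin n → ℝ
  c : Fin n → ℝ
  φ₀ : ℝ → Fin n → ℝ
  φ : ℝ → Fin m → ℝ

/-- `x` is a trajectory on `[0, ∞)` of the master system with parameter `θ`. -/
def Plant.IsTrajectory {n m : ℕ} (S : Plant n m) (θ : Fin m → ℝ) (x : ℝ → Fin n → ℝ) : Prop :=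
  ∀ t : ℝ, 0 ≤ t →
    HasDerivWithinAt x
      (S.A *ᵥ x t + S.φ₀ (S.c ⬝ᵥ x t) + (S.φ (S.c ⬝ᵥ x t) ⬝ᵥ θ) • S.b) (Set.Ici 0) t

/-- Every trajectory of the master system is bounded, whatever the parameter. -/
def Plant.BoundedTrajectories {n m : ℕ} (S : Plant n m) : Prop :=
  ∀ (θ : Fin m → ℝ) (x : ℝ → Fin n → ℝ), S.IsTrajectory θ x → BoundedSignal x

/-- `φ₀` and `φ` are bounded on bounded sets. -/
def Plant.LocallyBoundedNonlinearities {n m : ℕ} (S : Plant n m) : Prop :=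
  ∀ s : Set ℝ, Bornology.IsBounded s →
    Bornology.IsBounded (S.φ₀ '' s) ∧ Bornology.IsBounded (S.φ '' s)

/-- The matrix `F = A - k cᵀ`. -/
def Plant.errorMatrix {n m : ℕ} (S : Plant n m) (k : Fin n → ℝ) : Matrix (Fin n) (Fin n) ℝ :=
  S.A - Matrix.vecMulVec k S.c

/-- The transfer function `H(p) = cᵀ (p I - F)⁻¹ b`. -/
def Plant.H {n m : ℕ} (S : Plant n m) (k : Fin n → ℝ) : RatFunc ℝ :=
  transferFn (S.errorMatrix k) S.b S.c 0

/-- `v = W(p)[u]` with `W(p) = (p + lam) H(p)` (see `Plant.transferFn_W`), `z` being the state of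
the filter. -/
def Plant.WResponse {n m : ℕ} (S : Plant n m) (k : Fin n → ℝ) (lam : ℝ)
    (u : ℝ → ℝ) (z : ℝ → Fin n → ℝ) (v : ℝ → ℝ) : Prop :=
  FilterResponse (S.errorMatrix k) S.b ((S.errorMatrix k)ᵀ *ᵥ S.c + lam • S.c) (S.c ⬝ᵥ S.b) u z v

/-- Data of the tuner: the filter `(l, Γ, h)` and the normalization gain `μ`. -/
structure Tuner (q : ℕ) where
  Γ : Matrix (Fin q) (Fin q) ℝ
  h : Fin q → ℝ
  l : Fin q → ℝ
  μ : ℝ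

/-- The signals of the closed loop: state `x` of the master system, state `xhat` of the observer,
feedback `ν`, regressor `ϖ = W(p)[φ(y)]`, tuner signals `ψ i`, `η i`, estimate `θhat`, the states
`zφ i` of the filters generating `ϖ i`, and the state `zν` of the filter `W(p)` driven by `ν`. -/
structure Signals (n m q : ℕ) where
  x : ℝ → Fin n → ℝ
  xhat : ℝ → Fin n → ℝ
  ν : ℝ → ℝ
  ϖ : ℝ → Fin m → ℝ
  ψ : ℝ → Fin m → ℝ
  η : ℝ → Fin m → Fin q → ℝ
  θhat : ℝ → Fin m → ℝ
  zφ : ℝ → Fin m → Fin n → ℝ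
  zν : ℝ → Fin n → ℝ

/-- The equations of the closed loop on `[0, ∞)`, for a transfer function `H` of relative
degree `r`. Initial conditions are arbitrary. -/
structure IsClosedLoop {n m q : ℕ} (S : Plant n m) (k : Fin n → ℝ) (lam : ℝ) (r : ℕ)
    (D : Tuner q) (θ : Fin m → ℝ) (s : Signals n m q) : Prop where
  master : S.IsTrajectory θ s.x
  observer : ∀ t : ℝ, 0 ≤ t →
    HasDerivWithinAt s.xhat
      (S.A *ᵥ s.xhat t + S.φ₀ (S.c ⬝ᵥ s.x t) + s.ν t • S.b +
        (S.c ⬝ᵥ s.x t - S.c ⬝ᵥ s.xhat t) • k) (Set.Ici 0) t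
  regressor : ∀ i : Fin m,
    S.WResponse k lam (fun t => S.φ (S.c ⬝ᵥ s.x t) i) (fun t => s.zφ t i) (fun t => s.ϖ t i)
  /-- `ν = W(p)⁻¹[ϖᵀ θhat]`, that is, `W(p)[ν] = ϖᵀ θhat`. -/
  feedback : S.WResponse k lam s.ν s.zν (fun t => s.ϖ t ⬝ᵥ s.θhat t)
  psi : ∀ t : ℝ, 0 ≤ t →
    HasDerivWithinAt s.ψ ((S.c ⬝ᵥ s.x t - S.c ⬝ᵥ s.xhat t) • s.ϖ t) (Set.Ici 0) t
  eta : ∀ i : Fin m, ∀ t : ℝ, 0 ≤ t →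
    HasDerivWithinAt (fun τ => s.η τ i)
      ((1 + D.μ * (s.ϖ t ⬝ᵥ s.ϖ t)) • (D.Γ *ᵥ s.η t i + s.ψ t i • D.h)) (Set.Ici 0) t
  /-- If `r ≤ 2` the filters `η i` are not used, and the algorithm is `θhat' = ϖ e`. -/
  estimate : ∀ t : ℝ, 0 ≤ t → ∀ i : Fin m,
    s.θhat t i = if r ≤ 2 then s.ψ t i else D.l ⬝ᵥ s.η t i

/-- The quadruple used in `Plant.WResponse` realizes `(p + lam) H(p)`. -/
theorem Plant.transferFn_W {n m : ℕ} (S : Plant n m) (k : Fin n → ℝ) (lam : ℝ) :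
    transferFn (S.errorMatrix k) S.b ((S.errorMatrix k)ᵀ *ᵥ S.c + lam • S.c) (S.c ⬝ᵥ S.b) =
      (RatFunc.X + RatFunc.C lam) * S.H k := by
  unfold Plant.H
  set F := S.errorMatrix k with hF
  unfold transferFn
  set M : Matrix (Fin n) (Fin n) (RatFunc ℝ) :=
    (RatFunc.X : RatFunc ℝ) • (1 : Matrix (Fin n) (Fin n) (RatFunc ℝ)) - F.map RatFunc.C with hM
  have hMc : M = (algebraMap (Polynomial ℝ) (RatFunc ℝ)).mapMatrix F.charmatrix := by
    ext i j
    by_cases hij : i = j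
    · subst hij
      simp [hM, Matrix.charmatrix_apply_eq]
    · simp [hM, Matrix.charmatrix_apply_ne, hij]
  have hdet : IsUnit M.det := by
    rw [isUnit_iff_ne_zero, hMc, ← RingHom.map_det]
    intro h0
    exact F.charpoly_monic.ne_zero ((map_eq_zero_iff _ (RatFunc.algebraMap_injective ℝ)).1 h0)
  set w := M⁻¹ *ᵥ (fun i => (RatFunc.C (S.b i) : RatFunc ℝ)) with hw
  have hMw : M *ᵥ w = fun i => RatFunc.C (S.b i) := by
    rw [hw, Matrix.mulVec_mulVec, Matrix.mul_nonsing_inv _ hdet, Matrix.one_mulVec]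
  have hXw : (RatFunc.X : RatFunc ℝ) • w =
      F.map RatFunc.C *ᵥ w + fun i => RatFunc.C (S.b i) := by
    rw [← hMw, hM, Matrix.sub_mulVec, Matrix.smul_mulVec, Matrix.one_mulVec]
    abel
  have hg : (fun i => (RatFunc.C ((Fᵀ *ᵥ S.c + lam • S.c) i) : RatFunc ℝ)) =
      (fun i => RatFunc.C (S.c i)) ᵥ* F.map RatFunc.C +
        RatFunc.C lam • (fun i => (RatFunc.C (S.c i) : RatFunc ℝ)) := by
    ext i
    simp [Matrix.mulVec, Matrix.vecMul, dotProduct, map_sum, mul_comm]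
  have hd : (RatFunc.C (S.c ⬝ᵥ S.b) : RatFunc ℝ) =
      (fun i => RatFunc.C (S.c i)) ⬝ᵥ fun i => RatFunc.C (S.b i) := by
    simp [dotProduct, map_sum]
  have hX : (RatFunc.X : RatFunc ℝ) * ((fun i => RatFunc.C (S.c i)) ⬝ᵥ w) =
      (fun i => RatFunc.C (S.c i)) ⬝ᵥ (F.map RatFunc.C *ᵥ w) +
        (fun i => RatFunc.C (S.c i)) ⬝ᵥ fun i => RatFunc.C (S.b i) := by
    rw [← dotProduct_add, ← hXw, dotProduct_smul, smul_eq_mul]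
  rw [hg, hd, add_dotProduct, smul_dotProduct, ← Matrix.dotProduct_mulVec, map_zero, add_zero,
    add_mul, hX, smul_eq_mul]
  ring

end HOT

end

namespace HOT

/-! The state error splits as x - x̂ = δ + (Σ θᵢ zφᵢ - zν), where δ' = Fδ, because both sides are
driven through F by the same input φᵀθ - ν. Reading off the output gives e' = -λe + ϖᵀ(θ - θ̂) + ε
with an exponentially small ε (`IsClosedLoop.error_dynamics`). The shift η̃ᵢ = ηᵢ + ψᵢ Γ⁻¹h and the
static gain lᵀΓ⁻¹h = -1 turn the estimate into θ̂ = ψ + lᵀη̃; for r ≤ 2 the vectors η̃ᵢ are empty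
and the same formula holds, so one argument serves all r.

The Lyapunov function is V = e²/2 + |θ - ψ|²/2 + Σ η̃ᵢᵀPη̃ᵢ/2 + (3/4λ)U, where U pays for ε. The
terms in e ϖᵀ(θ - ψ) cancel. The remaining coupling of e with ϖ and η̃ is absorbed by λe²/3 and
μ|ϖ|²|η̃|², which is exactly what the lower bound on μ allows. Hence V' ≤ -λe²/3 - Σ|η̃ᵢ|²
(`tuner_decay`, `tuner_stability`): all tuner signals are bounded, e and η̃ are square integrable,
and Barbalat's lemma gives e → 0.

Boundedness of ν is a matter of counting derivatives. With ρ = r - 1 the relative degree of W,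
bounded φ(y) yields ϖ with ρ bounded derivatives; the differential equations of e, ψ, η̃ pass these
on to ϖᵀθ̂. Applying p + λ another ρ times to W[ν] = ϖᵀθ̂ exposes ν, and eliminating ν from the
filter state leaves a matrix with characteristic polynomial proportional to (p + λ)^(ρ+1) times the
numerator of H, which is Hurwitz in the minimum phase case (`hurwitzMatrix_inverse`,
`boundedSignal_inverse`).

For convergence put ϑ = θ - ψ. Then ϑ' = -eϖ → 0, η̃ → 0, and Barbalat's lemma applied to e gives
ϖᵀϑ → 0. As ϑ varies slowly, ϖᵀϑ is nearly W[φᵀϑ]; repeated use of Barbalat's lemma and the stable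
inverse give φᵀϑ → 0 (`tendsto_input_zero`). Excitation of φ over windows on which ϑ is almost
frozen forces ϑ → 0, hence θ̂ → θ. -/

/-- `f` has the derivative `f' t` at every `t ≥ 0` (one-sided at `0`). -/
def DerivOnIci {E : Type*} [NormedAddCommGroup E] [NormedSpace ℝ E] (f f' : ℝ → E) : Prop :=
  ∀ t : ℝ, 0 ≤ t → HasDerivWithinAt f (f' t) (Set.Ici 0) t

/-! ### One-sided calculus and comparison on [0, ∞). -/

section Calculus

variable {E : Type*} [NormedAddCommGroup E] [NormedSpace ℝ E]

theorem DerivOnIci.continuousOn {f f' : ℝ → E} (h : DerivOnIci f f') :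
    ContinuousOn f (Set.Ici 0) :=
  fun t ht => (h t ht).continuousWithinAt

theorem DerivOnIci.congr_deriv {f f' g' : ℝ → E} (h : DerivOnIci f f')
    (hg : ∀ t, 0 ≤ t → f' t = g' t) : DerivOnIci f g' :=
  fun t ht => hg t ht ▸ h t ht

theorem DerivOnIci.congr {f f' g : ℝ → E} (h : DerivOnIci f f')
    (hg : ∀ t, 0 ≤ t → g t = f t) : DerivOnIci g f' :=
  fun t ht => (h t ht).congr hg (hg t ht)

theorem DerivOnIci.unique {f f' g' : ℝ → E} (h : DerivOnIci f f') (h' : DerivOnIci f g')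
    {t : ℝ} (ht : 0 ≤ t) : f' t = g' t :=
  (uniqueDiffOn_Ici (0 : ℝ) t ht).eq_deriv _ (h t ht) (h' t ht)

theorem DerivOnIci.add {f f' g g' : ℝ → E} (hf : DerivOnIci f f') (hg : DerivOnIci g g') :
    DerivOnIci (fun t => f t + g t) (fun t => f' t + g' t) :=
  fun t ht => (hf t ht).add (hg t ht)

theorem DerivOnIci.sub {f f' g g' : ℝ → E} (hf : DerivOnIci f f') (hg : DerivOnIci g g') :
    DerivOnIci (fun t => f t - g t) (fun t => f' t - g' t) :=
  fun t ht => (hf t ht).sub (hg t ht)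

theorem DerivOnIci.const (c : E) : DerivOnIci (fun _ => c) (fun _ => 0) :=
  fun _ _ => hasDerivWithinAt_const _ _ _

theorem DerivOnIci.sum {ι : Type*} {s : Finset ι} {f f' : ι → ℝ → E}
    (h : ∀ i ∈ s, DerivOnIci (f i) (f' i)) :
    DerivOnIci (fun t => ∑ i ∈ s, f i t) (fun t => ∑ i ∈ s, f' i t) :=
  fun t ht => HasDerivWithinAt.fun_sum fun i hi => h i hi t ht

theorem DerivOnIci.smul {u u' : ℝ → ℝ} {f f' : ℝ → E} (hu : DerivOnIci u u')
    (hf : DerivOnIci f f') :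
    DerivOnIci (fun t => u t • f t) (fun t => u t • f' t + u' t • f t) :=
  fun t ht => (hu t ht).fun_smul (hf t ht)

theorem DerivOnIci.mul {f f' g g' : ℝ → ℝ} (hf : DerivOnIci f f') (hg : DerivOnIci g g') :
    DerivOnIci (fun t => f t * g t) (fun t => f' t * g t + f t * g' t) :=
  fun t ht => (hf t ht).fun_mul (hg t ht)

theorem DerivOnIci.const_mul (c : ℝ) {f f' : ℝ → ℝ} (hf : DerivOnIci f f') :
    DerivOnIci (fun t => c * f t) (fun t => c * f' t) :=
  fun t ht => (hf t ht).const_mul c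

theorem derivOnIci_pi {ι : Type*} [Fintype ι] {f f' : ℝ → ι → E} :
    DerivOnIci f f' ↔ ∀ i, DerivOnIci (fun t => f t i) (fun t => f' t i) := by
  simp only [DerivOnIci, hasDerivWithinAt_pi]
  exact ⟨fun h i t ht => h t ht i, fun h t ht i => h i t ht⟩

theorem DerivOnIci.dotProduct {n : ℕ} (a : Fin n → ℝ) {z z' : ℝ → Fin n → ℝ}
    (h : DerivOnIci z z') : DerivOnIci (fun t => a ⬝ᵥ z t) (fun t => a ⬝ᵥ z' t) :=
  DerivOnIci.sum fun i _ => (derivOnIci_pi.1 h i).const_mul (a i)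

theorem DerivOnIci.lipschitz {f f' : ℝ → E} (h : DerivOnIci f f') (hb : BoundedSignal f') :
    ∃ C : ℝ, 0 ≤ C ∧ ∀ s t : ℝ, 0 ≤ s → 0 ≤ t → ‖f t - f s‖ ≤ C * |t - s| := by
  obtain ⟨C, hC⟩ := hb
  refine ⟨C, (norm_nonneg _).trans (hC 0 le_rfl), fun s t hs ht => ?_⟩
  exact Convex.norm_image_sub_le_of_norm_hasDerivWithin_le h hC (convex_Ici 0) hs ht

theorem DerivOnIci.uniformContinuousOn {f f' : ℝ → E} (h : DerivOnIci f f')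
    (hb : BoundedSignal f') : UniformContinuousOn f (Set.Ici 0) := by
  obtain ⟨C, hC0, hC⟩ := h.lipschitz hb
  refine LipschitzOnWith.uniformContinuousOn (K := C.toNNReal) ?_
  refine LipschitzOnWith.of_dist_le_mul fun x hx y hy => ?_
  rw [dist_eq_norm, Real.dist_eq, Real.coe_toNNReal _ hC0]
  exact hC y x hy hx

theorem DerivOnIci.antitoneOn {f f' : ℝ → ℝ} (h : DerivOnIci f f')
    (h0 : ∀ t, 0 ≤ t → f' t ≤ 0) : AntitoneOn f (Set.Ici 0) :=
  antitoneOn_of_hasDerivWithinAt_nonpos (convex_Ici 0) h.continuousOn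
    (fun x hx => (h x (interior_subset hx)).mono interior_subset)
    fun x hx => h0 x (interior_subset hx)

/-- Comparison principle for `v' ≤ -a (v - c)` on `[t₀, ∞)`. -/
theorem DerivOnIci.le_of_le_neg_mul {v v' : ℝ → ℝ} {a c t₀ : ℝ} (h : DerivOnIci v v')
    (ht₀ : 0 ≤ t₀) (hv : ∀ t, t₀ ≤ t → v' t ≤ -a * (v t - c)) {t : ℝ} (ht : t₀ ≤ t) :
    v t - c ≤ (v t₀ - c) * Real.exp (-a * (t - t₀)) := by
  have hd : ∀ s, t₀ ≤ s → HasDerivWithinAt (fun s => (v s - c) * Real.exp (a * (s - t₀)))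
      (v' s * Real.exp (a * (s - t₀)) + (v s - c) * (Real.exp (a * (s - t₀)) * (a * 1)))
      (Set.Ici t₀) s := by
    intro s hs
    have h1 := ((h s (ht₀.trans hs)).mono (Set.Ici_subset_Ici.2 ht₀)).sub_const c
    exact h1.fun_mul ((((hasDerivWithinAt_id s _).sub_const t₀).const_mul a).exp)
  have hanti : AntitoneOn (fun s => (v s - c) * Real.exp (a * (s - t₀))) (Set.Ici t₀) := by
    refine antitoneOn_of_hasDerivWithinAt_nonpos (convex_Ici t₀)
      (fun s hs => (hd s hs).continuousWithinAt)
      (fun x hx => (hd x (interior_subset hx)).mono interior_subset) fun x hx => ?_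
    have h1 := hv x (interior_subset hx)
    have h2 := Real.exp_pos (a * (x - t₀))
    nlinarith
  have h3 := hanti (Set.self_mem_Ici) ht ht
  simp only [sub_self, mul_zero, Real.exp_zero, mul_one] at h3
  calc v t - c = (v t - c) * Real.exp (a * (t - t₀)) * Real.exp (-a * (t - t₀)) := by
        rw [mul_assoc, ← Real.exp_add]; simp
    _ ≤ _ := mul_le_mul_of_nonneg_right h3 (Real.exp_pos _).le

end Calculus

/-! ### Algebra of bounded signals. -/

section Bounded

variable {E : Type*} [NormedAddCommGroup E]

theorem BoundedSignal.congr {f g : ℝ → E} (hf : BoundedSignal f) (h : ∀ t, 0 ≤ t → g t = f t) :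
    BoundedSignal g := by
  obtain ⟨C, hC⟩ := hf
  exact ⟨C, fun t ht => by rw [h t ht]; exact hC t ht⟩

theorem BoundedSignal.const (c : E) : BoundedSignal fun _ => c := ⟨‖c‖, fun _ _ => le_rfl⟩

theorem BoundedSignal.add {f g : ℝ → E} (hf : BoundedSignal f) (hg : BoundedSignal g) :
    BoundedSignal fun t => f t + g t := by
  obtain ⟨C, hC⟩ := hf
  obtain ⟨D, hD⟩ := hg
  exact ⟨C + D, fun t ht => (norm_add_le _ _).trans (add_le_add (hC t ht) (hD t ht))⟩

theorem BoundedSignal.neg {f : ℝ → E} (hf : BoundedSignal f) : BoundedSignal fun t => -f t := by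
  simpa only [BoundedSignal, norm_neg] using hf

theorem BoundedSignal.sub {f g : ℝ → E} (hf : BoundedSignal f) (hg : BoundedSignal g) :
    BoundedSignal fun t => f t - g t := by
  simpa only [sub_eq_add_neg] using hf.add hg.neg

theorem BoundedSignal.smul {𝕜 : Type*} [NormedField 𝕜] [NormedSpace 𝕜 E] {u : ℝ → 𝕜} {f : ℝ → E}
    (hu : BoundedSignal u) (hf : BoundedSignal f) : BoundedSignal fun t => u t • f t := by
  obtain ⟨C, hC⟩ := hu
  obtain ⟨D, hD⟩ := hf
  refine ⟨C * D, fun t ht => (norm_smul _ _).trans_le ?_⟩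
  exact mul_le_mul (hC t ht) (hD t ht) (norm_nonneg _) ((norm_nonneg _).trans (hC t ht))

theorem BoundedSignal.mul {𝕜 : Type*} [NormedField 𝕜] {f g : ℝ → 𝕜} (hf : BoundedSignal f)
    (hg : BoundedSignal g) : BoundedSignal fun t => f t * g t :=
  hf.smul hg

theorem BoundedSignal.sum {ι : Type*} {s : Finset ι} {f : ι → ℝ → E}
    (h : ∀ i ∈ s, BoundedSignal (f i)) : BoundedSignal fun t => ∑ i ∈ s, f i t := by
  classical
  induction s using Finset.induction_on with
  | empty => simpa using BoundedSignal.const (0 : E)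
  | insert a s ha ih =>
    simp only [Finset.sum_insert ha]
    exact (h a (Finset.mem_insert_self _ _)).add
      (ih fun i hi => h i (Finset.mem_insert_of_mem hi))

theorem boundedSignal_pi {n : ℕ} {f : ℝ → Fin n → E} :
    BoundedSignal f ↔ ∀ i, BoundedSignal fun t => f t i := by
  constructor
  · rintro ⟨C, hC⟩ i
    exact ⟨C, fun t ht => (norm_le_pi_norm _ i).trans (hC t ht)⟩
  · intro h
    choose C hC using h
    refine ⟨∑ i, |C i|, fun t ht => (pi_norm_le_iff_of_nonneg
      (Finset.sum_nonneg fun i _ => abs_nonneg _)).2 fun i => ?_⟩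
    exact ((hC i t ht).trans (le_abs_self _)).trans
      (Finset.single_le_sum (f := fun i => |C i|) (fun i _ => abs_nonneg _) (Finset.mem_univ i))

theorem BoundedSignal.dotProduct {n : ℕ} {f g : ℝ → Fin n → ℝ} (hf : BoundedSignal f)
    (hg : BoundedSignal g) : BoundedSignal fun t => f t ⬝ᵥ g t :=
  BoundedSignal.sum fun i _ => (boundedSignal_pi.1 hf i).mul (boundedSignal_pi.1 hg i)

theorem BoundedSignal.mulVec {n m : ℕ} (M : Matrix (Fin m) (Fin n) ℝ) {f : ℝ → Fin n → ℝ}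
    (hf : BoundedSignal f) : BoundedSignal fun t => M *ᵥ f t :=
  boundedSignal_pi.2 fun i => (BoundedSignal.const (M i)).dotProduct hf

theorem BoundedSignal.smul_tendsto_zero {𝕜 : Type*} [NormedField 𝕜] [NormedSpace 𝕜 E]
    {u : ℝ → 𝕜} {f : ℝ → E} (hu : BoundedSignal u) (hf : Tendsto f atTop (𝓝 0)) :
    Tendsto (fun t => u t • f t) atTop (𝓝 0) := by
  obtain ⟨C, hC⟩ := hu
  rw [tendsto_zero_iff_norm_tendsto_zero] at hf ⊢
  refine squeeze_zero' (Eventually.of_forall fun _ => norm_nonneg _) ?_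
    (by simpa using hf.const_mul C)
  filter_upwards [eventually_ge_atTop 0] with t ht
  rw [norm_smul]
  exact mul_le_mul_of_nonneg_right (hC t ht) (norm_nonneg _)

theorem BoundedSignal.mul_tendsto_zero {u f : ℝ → ℝ} (hu : BoundedSignal u)
    (hf : Tendsto f atTop (𝓝 0)) : Tendsto (fun t => u t * f t) atTop (𝓝 0) :=
  hu.smul_tendsto_zero hf

theorem boundedSignal_of_sq_le {f : ℝ → E} {C : ℝ} (h : ∀ t, 0 ≤ t → ‖f t‖ ^ 2 ≤ C) :
    BoundedSignal f :=
  ⟨√C, fun t ht => Real.le_sqrt_of_sq_le (h t ht)⟩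

theorem BoundedSignal.mul_uniformContinuousOn {f g : ℝ → ℝ} (hf : BoundedSignal f)
    (hg : BoundedSignal g) (hfc : UniformContinuousOn f (Set.Ici 0))
    (hgc : UniformContinuousOn g (Set.Ici 0)) :
    UniformContinuousOn (fun t => f t * g t) (Set.Ici 0) := by
  obtain ⟨C, hC⟩ := hf
  obtain ⟨D, hD⟩ := hg
  have hC0 : 0 ≤ C := (norm_nonneg _).trans (hC 0 le_rfl)
  have hD0 : 0 ≤ D := (norm_nonneg _).trans (hD 0 le_rfl)
  rw [Metric.uniformContinuousOn_iff] at hfc hgc ⊢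
  intro ε hε
  have hK : 0 < C + D + 1 := by positivity
  obtain ⟨d₁, hd₁, h₁⟩ := hfc (ε / (C + D + 1)) (by positivity)
  obtain ⟨d₂, hd₂, h₂⟩ := hgc (ε / (C + D + 1)) (by positivity)
  refine ⟨min d₁ d₂, lt_min hd₁ hd₂, fun x hx y hy hxy => ?_⟩
  have e₁ := (h₁ x hx y hy (hxy.trans_le (min_le_left _ _))).le
  have e₂ := (h₂ x hx y hy (hxy.trans_le (min_le_right _ _))).le
  rw [Real.dist_eq] at e₁ e₂ ⊢
  have hfx := hC x hx
  have hgy := hD y hy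
  rw [Real.norm_eq_abs] at hfx hgy
  have key : f x * g x - f y * g y = f x * (g x - g y) + (f x - f y) * g y := by ring
  calc |f x * g x - f y * g y| ≤ |f x| * |g x - g y| + |f x - f y| * |g y| := by
        rw [key, ← abs_mul, ← abs_mul]; exact abs_add_le _ _
    _ ≤ C * (ε / (C + D + 1)) + ε / (C + D + 1) * D := by gcongr
    _ = (C + D) * (ε / (C + D + 1)) := by ring
    _ < (C + D + 1) * (ε / (C + D + 1)) := mul_lt_mul_of_pos_right (lt_add_one _) (by positivity)
    _ = ε := by field_simp

theorem uniformContinuousOn_finset_sum {ι : Type*} {s : Finset ι} {f : ι → ℝ → ℝ} {t : Set ℝ}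
    (h : ∀ i ∈ s, UniformContinuousOn (f i) t) :
    UniformContinuousOn (fun x => ∑ i ∈ s, f i x) t := by
  classical
  induction s using Finset.induction_on with
  | empty => simpa using uniformContinuous_const.uniformContinuousOn
  | insert a s ha ih =>
    simp only [Finset.sum_insert ha]
    have h1 := h a (Finset.mem_insert_self _ _)
    have h2 := ih fun i hi => h i (Finset.mem_insert_of_mem hi)
    rw [uniformContinuousOn_iff_restrict] at h1 h2 ⊢
    exact h1.add h2

end Bounded

/-! ### Barbalat's lemma in two forms. -/

section Convergence

/-- Barbalat's lemma: if `f → 0` and `f'` is asymptotic to a uniformly continuous `g`,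
then `g → 0`. -/
theorem tendsto_zero_of_derivOnIci {f f' g : ℝ → ℝ} (hf : DerivOnIci f f')
    (h0 : Tendsto f atTop (𝓝 0)) (hg : UniformContinuousOn g (Set.Ici 0))
    (hfg : Tendsto (fun t => f' t - g t) atTop (𝓝 0)) : Tendsto g atTop (𝓝 0) := by
  rw [Metric.tendsto_atTop] at h0 hfg ⊢
  intro ε hε
  rw [Metric.uniformContinuousOn_iff] at hg
  obtain ⟨d, hd, hgd⟩ := hg (ε / 4) (by positivity)
  obtain ⟨T₁, hT₁⟩ := hfg (ε / 4) (by positivity)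
  obtain ⟨T₂, hT₂⟩ := h0 (d / 2 * (ε / 8)) (by positivity)
  refine ⟨max 0 (max T₁ T₂), fun t ht => ?_⟩
  have ht0 : 0 ≤ t := (le_max_left _ _).trans ht
  have ht1 : T₁ ≤ t := (le_max_left _ _).trans ((le_max_right _ _).trans ht)
  have ht2 : T₂ ≤ t := (le_max_right _ _).trans ((le_max_right _ _).trans ht)
  have hsub : Set.Icc t (t + d / 2) ⊆ Set.Ici 0 := fun s hs => ht0.trans hs.1
  -- On [t, t + d/2] the derivative of f stays within ε/2 of the constant g(t). If |g(t)| ≥ ε, then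
  -- f would move by at least (d/2)(ε/2), yet both endpoint values are below (d/2)(ε/8). The mean
  -- value inequality avoids any integrability requirement on f'.
  have hmv := Convex.norm_image_sub_le_of_norm_hasDerivWithin_le
    (f := fun s => f s - s * g t) (f' := fun s => f' s - 1 * g t) (C := ε / 2)
    (s := Set.Icc t (t + d / 2)) (x := t) (y := t + d / 2)
    (fun s hs => ((hf s (hsub hs)).mono hsub).sub ((hasDerivWithinAt_id s _).mul_const (g t)))
    (fun s hs => ?_) (convex_Icc _ _) ⟨le_rfl, by linarith⟩ ⟨by linarith, le_rfl⟩
  · have e₁ := hT₂ t ht2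
    have e₂ := hT₂ (t + d / 2) (by linarith)
    simp only [Real.dist_eq, sub_zero, Real.norm_eq_abs] at e₁ e₂ hmv ⊢
    rw [add_sub_cancel_left, abs_of_pos (by positivity : 0 < d / 2)] at hmv
    rw [abs_lt] at e₁ e₂ ⊢
    rw [abs_le] at hmv
    have hd2 : 0 < d / 2 := by positivity
    constructor
    · by_contra hcon
      push Not at hcon
      nlinarith [mul_le_mul_of_nonneg_left hcon hd2.le]
    · by_contra hcon
      push Not at hcon
      nlinarith [mul_le_mul_of_nonneg_left hcon hd2.le]
  · have e₁ := hT₁ s (ht1.trans hs.1)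
    have e₂ := hgd s (hsub hs) t ht0 (by
      rw [Real.dist_eq, abs_lt]; constructor <;> linarith [hs.1, hs.2])
    simp only [Real.dist_eq, sub_zero, Real.norm_eq_abs, one_mul] at e₁ e₂ ⊢
    rw [abs_lt] at e₁ e₂
    rw [abs_le]
    constructor <;> linarith

/-- A nonnegative differentiable function dissipates `f` if it decreases at a rate at
least `‖f‖²`; in particular `f` is then square integrable. -/
def Dissipated {E : Type*} [Norm E] (f : ℝ → E) : Prop :=
  ∃ U U' : ℝ → ℝ, DerivOnIci U U' ∧ ∀ t, 0 ≤ t → 0 ≤ U t ∧ U' t ≤ -‖f t‖ ^ 2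

/-- Barbalat's lemma for dissipated signals. -/
theorem Dissipated.tendsto_zero {E : Type*} [NormedAddCommGroup E] {f : ℝ → E}
    (hf : Dissipated f) (hc : UniformContinuousOn f (Set.Ici 0)) : Tendsto f atTop (𝓝 0) := by
  obtain ⟨U, U', hU, h⟩ := hf
  have hanti := hU.antitoneOn fun t ht => (h t ht).2.trans (by nlinarith [sq_nonneg ‖f t‖])
  obtain ⟨ℓ, hℓ⟩ : ∃ ℓ, Tendsto (fun t => U (max t 0)) atTop (𝓝 ℓ) := by
    refine ⟨_, tendsto_atTop_ciInf (fun s t hst => ?_) ⟨0, ?_⟩⟩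
    · exact hanti (le_max_right s 0) (le_max_right t 0) (max_le_max hst le_rfl)
    · rintro _ ⟨t, rfl⟩
      exact (h _ (le_max_right t 0)).1
  rw [Metric.tendsto_atTop] at hℓ ⊢
  intro ε hε
  rw [Metric.uniformContinuousOn_iff] at hc
  obtain ⟨d, hd, hfd⟩ := hc (ε / 2) (by positivity)
  obtain ⟨T, hT⟩ := hℓ (d / 2 * (ε / 2) ^ 2 / 2) (by positivity)
  refine ⟨max 0 T, fun t ht => ?_⟩
  have ht0 : 0 ≤ t := (le_max_left _ _).trans ht
  have ht1 : T ≤ t := (le_max_right _ _).trans ht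
  by_contra hcon
  rw [dist_zero_right, not_lt] at hcon
  have hsub : Set.Icc t (t + d / 2) ⊆ Set.Ici 0 := fun s hs => ht0.trans hs.1
  -- If ‖f t‖ ≥ ε, then ‖f‖ ≥ ε/2 on the whole interval and U falls by at least (ε/2)²·d/2. This
  -- contradicts that U is within half of that amount of its limit at both ends.
  have hdec : AntitoneOn (fun s => U s + (ε / 2) ^ 2 * s) (Set.Icc t (t + d / 2)) := by
    have hd' : ∀ s ∈ Set.Icc t (t + d / 2), HasDerivWithinAt (fun s => U s + (ε / 2) ^ 2 * s)
        (U' s + (ε / 2) ^ 2 * 1) (Set.Icc t (t + d / 2)) s := fun s hs =>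
      ((hU s (hsub hs)).mono hsub).fun_add ((hasDerivWithinAt_id s _).const_mul _)
    refine antitoneOn_of_hasDerivWithinAt_nonpos (convex_Icc _ _)
      (fun s hs => (hd' s hs).continuousWithinAt)
      (fun s hs => (hd' s (interior_subset hs)).mono interior_subset) fun s hs => ?_
    replace hs := interior_subset hs
    have e₁ := (h s (hsub hs)).2
    have e₂ := hfd s (hsub hs) t ht0 (by
      rw [Real.dist_eq, abs_lt]; constructor <;> linarith [hs.1, hs.2])
    rw [dist_eq_norm, norm_sub_rev] at e₂
    have e₃ : ε / 2 ≤ ‖f s‖ := by linarith [norm_sub_norm_le (f t) (f s)]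
    nlinarith
  have h1 := hdec ⟨le_rfl, by linarith⟩ ⟨by linarith, le_rfl⟩ (by linarith : t ≤ t + d / 2)
  have e₁ := hT t ht1
  have e₂ := hT (t + d / 2) (by linarith)
  rw [max_eq_left (by linarith), Real.dist_eq, abs_lt] at e₁ e₂
  simp only at h1
  nlinarith

end Convergence

/-! ### Stable scalar equations w' = λw + f over ℂ. -/

section ScalarStability

variable {lam : ℂ} {w f : ℝ → ℂ}

theorem derivOnIci_norm_sq (hw : DerivOnIci w fun t => lam * w t + f t) :
    ∃ v' : ℝ → ℝ, DerivOnIci (fun t => ‖w t‖ ^ 2) v' ∧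
      ∀ t, v' t ≤ 2 * lam.re * ‖w t‖ ^ 2 + 2 * (‖w t‖ * ‖f t‖) := by
  refine ⟨fun t => 2 * inner ℝ (w t) (lam * w t + f t), fun t ht => (hw t ht).norm_sq,
    fun t => ?_⟩
  have h1 : inner ℝ (w t) (lam * w t) = lam.re * ‖w t‖ ^ 2 := by
    rw [Complex.sq_norm, Complex.normSq_apply]
    simp [Complex.inner]
    ring
  change 2 * inner ℝ (w t) (lam * w t + f t) ≤ _
  rw [inner_add_right, h1]
  linarith [real_inner_le_norm (w t) (f t)]

/-- Young's inequality with weight -Re λ: half of the damping pays for the cross term. The three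
stability properties below all follow from this one estimate. -/
theorem derivOnIci_norm_sq_le (hlam : lam.re < 0) (hw : DerivOnIci w fun t => lam * w t + f t) :
    ∃ v' : ℝ → ℝ, DerivOnIci (fun t => ‖w t‖ ^ 2) v' ∧
      ∀ t, v' t ≤ -(-lam.re) * ‖w t‖ ^ 2 + ‖f t‖ ^ 2 / (-lam.re) := by
  obtain ⟨v', hv, h⟩ := derivOnIci_norm_sq hw
  refine ⟨v', hv, fun t => (h t).trans ?_⟩
  have ha : 0 < -lam.re := by linarith
  have key : 2 * (‖w t‖ * ‖f t‖) ≤ -lam.re * ‖w t‖ ^ 2 + ‖f t‖ ^ 2 / (-lam.re) := by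
    have : 0 ≤ (-lam.re * ‖w t‖ - ‖f t‖) ^ 2 / (-lam.re) := by positivity
    have e : (-lam.re * ‖w t‖ - ‖f t‖) ^ 2 / (-lam.re) =
        -lam.re * ‖w t‖ ^ 2 + ‖f t‖ ^ 2 / (-lam.re) - 2 * (‖w t‖ * ‖f t‖) := by
      have := hlam.ne
      field_simp
      ring
    linarith
  linarith

theorem boundedSignal_of_derivOnIci (hlam : lam.re < 0)
    (hw : DerivOnIci w fun t => lam * w t + f t) (hf : BoundedSignal f) : BoundedSignal w := by
  obtain ⟨v', hv, h⟩ := derivOnIci_norm_sq_le hlam hw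
  obtain ⟨C, hC⟩ := hf
  have ha : 0 < -lam.re := by linarith
  set K := C ^ 2 / (-lam.re) / (-lam.re) with hK
  have hle : ∀ t, 0 ≤ t → v' t ≤ -(-lam.re) * (‖w t‖ ^ 2 - K) := fun t ht => by
    have h2 : ‖f t‖ ^ 2 / (-lam.re) ≤ C ^ 2 / (-lam.re) := by
      gcongr
      exact hC t ht
    have h3 : -lam.re * K = C ^ 2 / (-lam.re) := by rw [hK]; field_simp
    linarith [h t]
  refine boundedSignal_of_sq_le (C := K + |‖w 0‖ ^ 2 - K|) fun t ht => ?_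
  have h4 := hv.le_of_le_neg_mul le_rfl hle ht
  have h5 : Real.exp (-(-lam.re) * (t - 0)) ≤ 1 := Real.exp_le_one_iff.2 (by nlinarith)
  have h6 := Real.exp_pos (-(-lam.re) * (t - 0))
  have h7 : (‖w 0‖ ^ 2 - K) * Real.exp (-(-lam.re) * (t - 0)) ≤ |‖w 0‖ ^ 2 - K| := by
    nlinarith [le_abs_self (‖w 0‖ ^ 2 - K), abs_nonneg (‖w 0‖ ^ 2 - K)]
  linarith

theorem tendsto_zero_of_derivOnIci_forced (hlam : lam.re < 0)
    (hw : DerivOnIci w fun t => lam * w t + f t) (hf : Tendsto f atTop (𝓝 0)) :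
    Tendsto w atTop (𝓝 0) := by
  obtain ⟨v', hv, h⟩ := derivOnIci_norm_sq_le hlam hw
  have ha : 0 < -lam.re := by linarith
  rw [Metric.tendsto_atTop] at hf ⊢
  intro ε hε
  obtain ⟨T, hT⟩ := hf (-lam.re * (ε / 2)) (by positivity)
  set T' := max 0 T
  have hle : ∀ t, T' ≤ t → v' t ≤ -(-lam.re) * (‖w t‖ ^ 2 - (ε / 2) ^ 2) := fun t ht => by
    have h1 := hT t ((le_max_right _ _).trans ht)
    rw [dist_zero_right] at h1
    have h2 : ‖f t‖ ^ 2 / (-lam.re) ≤ (-lam.re * (ε / 2)) ^ 2 / (-lam.re) := by gcongr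
    have h3 : (-lam.re * (ε / 2)) ^ 2 / (-lam.re) = -lam.re * (ε / 2) ^ 2 := by field_simp
    linarith [h t]
  have hexp : Tendsto (fun t => (‖w T'‖ ^ 2 - (ε / 2) ^ 2) * Real.exp (-(-lam.re) * (t - T')))
      atTop (𝓝 0) := by
    have hb : Tendsto (fun t => -(-lam.re) * (t - T')) atTop atBot := (tendsto_atTop_add_const_right _ _ tendsto_id).const_mul_atTop_of_neg (by linarith)
    simpa using (Real.tendsto_exp_atBot.comp hb).const_mul (‖w T'‖ ^ 2 - (ε / 2) ^ 2)
  obtain ⟨T₁, hT₁⟩ := (Metric.tendsto_atTop.1 hexp) ((ε / 2) ^ 2) (by positivity)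
  refine ⟨max T' T₁, fun t ht => ?_⟩
  have h4 := hv.le_of_le_neg_mul (le_max_left 0 T) hle ((le_max_left _ _).trans ht)
  have h5 := hT₁ t ((le_max_right _ _).trans ht)
  rw [Real.dist_eq, sub_zero, abs_lt] at h5
  rw [dist_zero_right]
  refine lt_of_pow_lt_pow_left₀ 2 hε.le ?_
  nlinarith [h5.2]

theorem dissipated_of_derivOnIci (hlam : lam.re < 0)
    (hw : DerivOnIci w fun t => lam * w t + f t) (hf : Dissipated f) : Dissipated w := by
  obtain ⟨v', hv, h⟩ := derivOnIci_norm_sq_le hlam hw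
  obtain ⟨U, U', hU, hU'⟩ := hf
  have ha : 0 < -lam.re := by linarith
  -- With a = -Re λ, the function that decreases fast enough is a⁻¹(‖w‖² + a⁻¹U): the decrease of U
  -- cancels the forcing term ‖f‖²/a.
  refine ⟨_, _, (hv.add (hU.const_mul (-lam.re)⁻¹)).const_mul (-lam.re)⁻¹, fun t ht => ⟨?_, ?_⟩⟩
  · have := (hU' t ht).1
    positivity
  · have h1 := h t
    have h2 : (-lam.re)⁻¹ * U' t ≤ (-lam.re)⁻¹ * -‖f t‖ ^ 2 := by
      gcongr
      exact (hU' t ht).2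
    calc (-lam.re)⁻¹ * (v' t + (-lam.re)⁻¹ * U' t)
        ≤ (-lam.re)⁻¹ * (-(-lam.re) * ‖w t‖ ^ 2 + ‖f t‖ ^ 2 / (-lam.re) +
          (-lam.re)⁻¹ * -‖f t‖ ^ 2) := by gcongr
      _ = -‖w t‖ ^ 2 := by
        have := hlam.ne
        field_simp
        ring

end ScalarStability

/-! ### Hurwitz systems, mode by mode. -/

section Stability

variable {n : ℕ} {F : Matrix (Fin n) (Fin n) ℝ} {z f : ℝ → Fin n → ℝ}

/-- Induction over the modes of a stable linear system `z' = F z + f`: a property of signals that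
is inherited by the solutions of stable scalar equations holds for all linear functionals of the
state. -/
theorem HurwitzMatrix.mode_induction (hF : HurwitzMatrix F)
    (hz : DerivOnIci z fun t => F *ᵥ z t + f t) (Q : (ℝ → ℂ) → Prop) (h0 : Q fun _ => 0)
    (hstep : ∀ (lam : ℂ) (a : Fin n → ℂ) (w w₁ : ℝ → ℂ), lam.re < 0 →
      DerivOnIci w (fun t => lam * w t + (w₁ t + a ⬝ᵥ fun i => (f t i : ℂ))) → Q w₁ → Q w)
    (a : Fin n → ℂ) : Q fun t => a ⬝ᵥ fun i => (z t i : ℂ) := by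
  set Fc : Matrix (Fin n) (Fin n) ℂ := F.map (algebraMap ℝ ℂ) with hFc
  have hroots : ∀ lam ∈ Fc.charpoly.roots, lam.re < 0 := by
    intro lam hlam
    refine hF.2 lam ?_
    have h1 := (Polynomial.mem_roots'.1 hlam).2
    rwa [hFc, Matrix.charpoly_map, Polynomial.IsRoot.def, Polynomial.eval_map_algebraMap] at h1
  have hprod : Polynomial.aeval Fc
      ((Fc.charpoly.roots.map fun lam => Polynomial.X - Polynomial.C lam).prod) = 0 := by
    rw [← (IsAlgClosed.splits Fc.charpoly).eq_prod_roots_of_monic Fc.charpoly_monic]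
    exact Matrix.aeval_self_charpoly Fc
  -- By Cayley–Hamilton, the product of the factors Fc - λ over all eigenvalues annihilates every
  -- row a. Stripping one factor at a time, a·z solves a scalar equation with rate λ, forced by the
  -- functional a(Fc - λ) of z, which needs one factor fewer. No Jordan form is required.
  have hind : ∀ s : Multiset ℂ, (∀ lam ∈ s, lam.re < 0) → ∀ a : Fin n → ℂ,
      a ᵥ* Polynomial.aeval Fc ((s.map fun lam => Polynomial.X - Polynomial.C lam).prod) = 0 →
      Q fun t => a ⬝ᵥ fun i => (z t i : ℂ) := by
    intro s
    induction s using Multiset.induction_on with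
    | empty =>
      intro _ a ha
      simp only [Multiset.map_zero, Multiset.prod_zero, map_one, Matrix.vecMul_one] at ha
      simpa [ha] using h0
    | cons lam s ih =>
      intro hs a ha
      rw [Multiset.map_cons, Multiset.prod_cons, map_mul, ← Matrix.vecMul_vecMul] at ha
      refine hstep lam a _ _ (hs lam (Multiset.mem_cons_self _ _)) ?_
        (ih (fun x hx => hs x (Multiset.mem_cons_of_mem hx)) _ ha)
      have hzi : ∀ i, DerivOnIci (fun t => (z t i : ℂ))
          (fun t => (((F *ᵥ z t + f t) i : ℝ) : ℂ)) := fun i t ht =>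
        (derivOnIci_pi.1 hz i t ht).ofReal_comp
      have hd : DerivOnIci (fun t => a ⬝ᵥ fun i => (z t i : ℂ))
          (fun t => a ⬝ᵥ fun i => (((F *ᵥ z t + f t) i : ℝ) : ℂ)) :=
        DerivOnIci.sum fun i _ t ht => (hzi i t ht).const_mul (a i)
      refine hd.congr_deriv fun t _ => ?_
      have e1 : (fun i => (((F *ᵥ z t + f t) i : ℝ) : ℂ)) =
          Fc *ᵥ (fun i => (z t i : ℂ)) + fun i => (f t i : ℂ) := by
        ext i
        simp [hFc, Matrix.mulVec, dotProduct]
      have e2 : Polynomial.aeval Fc (Polynomial.X - Polynomial.C lam) = Fc - lam • 1 := by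
        simp [Algebra.algebraMap_eq_smul_one]
      rw [e1, e2, dotProduct_add, ← Matrix.dotProduct_mulVec, Matrix.sub_mulVec,
        Matrix.smul_mulVec, Matrix.one_mulVec, dotProduct_sub, dotProduct_smul, smul_eq_mul]
      ring
  exact hind _ hroots a (by rw [hprod, Matrix.vecMul_zero])

theorem dotProduct_ofReal (a v : Fin n → ℝ) :
    ((fun i => (a i : ℂ)) ⬝ᵥ fun i => (v i : ℂ)) = ((a ⬝ᵥ v : ℝ) : ℂ) := by
  simp [dotProduct]

theorem HurwitzMatrix.boundedSignal (hF : HurwitzMatrix F)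
    (hz : DerivOnIci z fun t => F *ᵥ z t + f t) (hf : BoundedSignal f) : BoundedSignal z := by
  have hfc : BoundedSignal fun t => fun i => (f t i : ℂ) := boundedSignal_pi.2 fun i => by
    simpa [BoundedSignal] using boundedSignal_pi.1 hf i
  have key := hF.mode_induction hz BoundedSignal (BoundedSignal.const 0)
    fun lam a w w₁ hlam hw hw₁ => boundedSignal_of_derivOnIci hlam hw <| hw₁.add <|
      BoundedSignal.sum fun i _ => (BoundedSignal.const (a i)).mul (boundedSignal_pi.1 hfc i)
  refine boundedSignal_pi.2 fun i => ?_
  simpa [BoundedSignal] using key (Pi.single i 1)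

theorem HurwitzMatrix.tendsto_zero (hF : HurwitzMatrix F)
    (hz : DerivOnIci z fun t => F *ᵥ z t + f t) (hf : Tendsto f atTop (𝓝 0)) :
    Tendsto z atTop (𝓝 0) := by
  rw [tendsto_pi_nhds] at hf ⊢
  have hfc : ∀ i, Tendsto (fun t => (f t i : ℂ)) atTop (𝓝 0) := fun i => by
    simpa using (hf i).ofReal
  have key := hF.mode_induction hz (fun w => Tendsto w atTop (𝓝 0)) tendsto_const_nhds
    fun lam a w w₁ hlam hw hw₁ => tendsto_zero_of_derivOnIci_forced hlam hw <| by
      simpa [dotProduct] using hw₁.add (tendsto_finsetSum Finset.univ fun i _ => (hfc i).const_mul (a i))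
  intro i
  have h1 := (Complex.continuous_re.tendsto _).comp (key (Pi.single i 1))
  simpa [Function.comp_def] using h1

theorem HurwitzMatrix.dissipated (hF : HurwitzMatrix F)
    (hz : DerivOnIci z fun t => F *ᵥ z t) (a : Fin n → ℝ) : Dissipated fun t => a ⬝ᵥ z t := by
  have hz' : DerivOnIci z fun t => F *ᵥ z t + (fun _ => 0 : ℝ → Fin n → ℝ) t :=
    hz.congr_deriv fun t _ => (add_zero _).symm
  have key := hF.mode_induction hz' Dissipated
    ⟨fun _ => 0, fun _ => 0, DerivOnIci.const 0, fun t _ => by simp⟩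
    fun lam a w w₁ hlam hw hw₁ => dissipated_of_derivOnIci hlam
      (hw.congr_deriv fun t _ => by simp [dotProduct]) hw₁
  simpa [dotProduct_ofReal, Dissipated] using key fun i => (a i : ℂ)

end Stability

/-! ### Numerators, Markov parameters and zeros of transfer functions. -/

section Transfer

open Polynomial

variable {n : ℕ} (F : Matrix (Fin n) (Fin n) ℝ) (b : Fin n → ℝ)

/-- The (unreduced) numerator `aᵀ adj(p I - F) b` of `aᵀ (p I - F)⁻¹ b`. -/
noncomputable def numer (a : Fin n → ℝ) : ℝ[X] :=
  (fun i => C (a i)) ⬝ᵥ (F.charmatrix.adjugate *ᵥ fun i => C (b i))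

theorem transferFn_eq_numer_div (a : Fin n → ℝ) :
    transferFn F b a 0 =
      algebraMap ℝ[X] (RatFunc ℝ) (numer F b a) / algebraMap ℝ[X] (RatFunc ℝ) F.charpoly := by
  set φ := algebraMap ℝ[X] (RatFunc ℝ)
  have hM : ((RatFunc.X : RatFunc ℝ) • (1 : Matrix (Fin n) (Fin n) (RatFunc ℝ)) -
      F.map RatFunc.C) = φ.mapMatrix F.charmatrix := by
    ext i j
    by_cases hij : i = j
    · subst hij
      simp [φ, Matrix.charmatrix_apply_eq]
    · simp [φ, Matrix.charmatrix_apply_ne, hij]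
  have hdet : (φ.mapMatrix F.charmatrix).det = φ F.charpoly := by
    rw [← RingHom.map_det, Matrix.charpoly]
  unfold transferFn
  rw [hM, Matrix.inv_def, ← RingHom.map_adjugate, hdet, Ring.inverse_eq_inv', Matrix.smul_mulVec,
    dotProduct_smul, map_zero, add_zero, smul_eq_mul, div_eq_inv_mul]
  congr 1
  simp [numer, dotProduct, Matrix.mulVec, φ, map_sum]

/-- Polynomial form of aᵀ(F + s)(p - F)⁻¹b = (p + s)aᵀ(p - F)⁻¹b - aᵀb, obtained by solving (p - F)
adj(p - F) = χ(p) I for F adj(p - F). -/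
theorem numer_shift (a : Fin n → ℝ) (s : ℝ) :
    numer F b (Fᵀ *ᵥ a + s • a) = (X + C s) * numer F b a - C (a ⬝ᵥ b) * F.charpoly := by
  have hadj : F.map C * F.charmatrix.adjugate =
      (X : ℝ[X]) • F.charmatrix.adjugate - F.charpoly • (1 : Matrix (Fin n) (Fin n) ℝ[X]) := by
    rw [Matrix.charpoly, ← Matrix.mul_adjugate]
    have : F.charmatrix = (X : ℝ[X]) • (1 : Matrix (Fin n) (Fin n) ℝ[X]) - F.map C := by
      rw [Matrix.charmatrix, Matrix.smul_one_eq_diagonal]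
      rfl
    have h2 : F.charmatrix * F.charmatrix.adjugate =
        ((X : ℝ[X]) • (1 : Matrix (Fin n) (Fin n) ℝ[X]) - F.map C) * F.charmatrix.adjugate :=
      congrArg (· * F.charmatrix.adjugate) this
    rw [h2, Matrix.sub_mul, Matrix.smul_mul, Matrix.one_mul, sub_sub_cancel]
  have hrow : (fun i => C ((Fᵀ *ᵥ a + s • a) i)) =
      (fun i => C (a i)) ᵥ* F.map C + C s • fun i => C (a i) := by
    ext1 i
    simp [Matrix.mulVec, Matrix.vecMul, dotProduct, mul_comm]
  have hab : C (a ⬝ᵥ b) = (fun i => C (a i)) ⬝ᵥ fun i => C (b i) := by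
    simp [dotProduct]
  unfold numer
  rw [hrow, add_dotProduct, ← Matrix.dotProduct_mulVec, Matrix.mulVec_mulVec, hadj,
    Matrix.sub_mulVec, Matrix.smul_mulVec, Matrix.smul_mulVec, Matrix.one_mulVec, dotProduct_sub,
    dotProduct_smul, dotProduct_smul, smul_dotProduct, hab]
  simp only [smul_eq_mul]
  ring

/-- Let N be the largest degree over the basis rows, hence over all rows. If N ≥ n, then
`numer_shift` applied to a maximizing row produces degree N + 1, since χ has degree only n and
cannot cancel the leading term; this contradicts maximality. -/
theorem natDegree_numer_lt (hn : 0 < n) (a : Fin n → ℝ) : (numer F b a).natDegree < n := by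
  set N := Finset.univ.sup fun i : Fin n => (numer F b (Pi.single i 1)).natDegree with hN
  have hlin : ∀ a, numer F b a = ∑ i, C (a i) * numer F b (Pi.single i 1) := by
    intro a
    unfold numer
    rw [dotProduct]
    refine Finset.sum_congr rfl fun i _ => ?_
    congr 1
    rw [show (fun j => C ((Pi.single i 1 : Fin n → ℝ) j)) = Pi.single i (1 : ℝ[X]) by
      ext1 j; rcases eq_or_ne j i with rfl | h <;> simp [*], single_one_dotProduct]
  have hle : ∀ a, (numer F b a).natDegree ≤ N := by
    intro a
    rw [hlin a]
    refine natDegree_sum_le_of_forall_le _ _ fun i _ => ?_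
    exact (natDegree_C_mul_le _ _).trans (Finset.le_sup (f := fun i : Fin n =>
      (numer F b (Pi.single i 1)).natDegree) (Finset.mem_univ i))
  refine (hle a).trans_lt ?_
  by_contra hcon
  push Not at hcon
  obtain ⟨i, -, hi⟩ := Finset.exists_mem_eq_sup Finset.univ
    (⟨⟨0, hn⟩, Finset.mem_univ _⟩ : (Finset.univ : Finset (Fin n)).Nonempty)
    fun i : Fin n => (numer F b (Pi.single i 1)).natDegree
  rw [← hN] at hi
  set p := numer F b (Pi.single i 1)
  have hp : p ≠ 0 := by
    intro h0
    rw [h0, natDegree_zero] at hi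
    omega
  have h1 := numer_shift F b (Pi.single i 1) 0
  have h2 := hle (Fᵀ *ᵥ Pi.single i 1 + (0 : ℝ) • Pi.single i 1)
  have h3 : ((X + C 0) * p).coeff (N + 1) ≠ 0 := by
    rw [C_0, add_zero, coeff_X_mul, hi]
    exact leadingCoeff_ne_zero.2 hp
  have h4 : (C ((Pi.single i 1 : Fin n → ℝ) ⬝ᵥ b) * F.charpoly).coeff (N + 1) = 0 := by
    refine coeff_eq_zero_of_natDegree_lt ((natDegree_C_mul_le _ _).trans_lt ?_)
    rw [Matrix.charpoly_natDegree_eq_dim, Fintype.card_fin]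
    omega
  have h5 := coeff_eq_zero_of_natDegree_lt (h2.trans_lt (Nat.lt_succ_self N))
  rw [h1, coeff_sub, h4, sub_zero] at h5
  exact h3 h5

/-- Compare coefficients of p^n in `numer_shift` with s = 0; the left side has none, by the degree
bound. -/
theorem numer_coeff (hn : 0 < n) (a : Fin n → ℝ) : (numer F b a).coeff (n - 1) = a ⬝ᵥ b := by
  have h1 := congrArg (fun p => p.coeff n) (numer_shift F b a 0)
  have h2 := coeff_eq_zero_of_natDegree_lt (natDegree_numer_lt F b hn (Fᵀ *ᵥ a + (0 : ℝ) • a))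
  have h3 : F.charpoly.coeff n = 1 := by
    have := F.charpoly_monic.coeff_natDegree
    rwa [Matrix.charpoly_natDegree_eq_dim, Fintype.card_fin] at this
  obtain ⟨k, rfl⟩ : ∃ k, n = k + 1 := ⟨n - 1, by omega⟩
  simp only [h2, coeff_sub, coeff_C_mul, C_0, add_zero, coeff_X_mul, h3] at h1
  simp only [Nat.add_sub_cancel]
  linarith

variable (c : Fin n → ℝ) (lam : ℝ)

/-- The rows `cᵀ (F + lam I) ^ j`. -/
noncomputable def shiftedRow : ℕ → Fin n → ℝ
  | 0 => c
  | j + 1 => Fᵀ *ᵥ shiftedRow j + lam • shiftedRow j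

theorem numer_shiftedRow (j : ℕ) (h : ∀ i < j, shiftedRow F c lam i ⬝ᵥ b = 0) :
    numer F b (shiftedRow F c lam j) = (X + C lam) ^ j * numer F b c := by
  induction j with
  | zero => simp [shiftedRow]
  | succ j ih =>
    rw [shiftedRow, numer_shift, ih fun i hi => h i (by omega), h j (by omega)]
    simp only [C_0, zero_mul, sub_zero]
    ring

theorem numer_ne_zero (h : transferFn F b c 0 ≠ 0) : numer F b c ≠ 0 := by
  rintro h0
  rw [transferFn_eq_numer_div, h0, map_zero, zero_div] at h
  exact h rfl

/-- A transfer function of relative degree `r` has `r - 1` vanishing (shifted) Markov parameters,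
followed by a nonzero one. -/
theorem HasRelativeDegree.shiftedRow {r : ℕ} (h : HasRelativeDegree (transferFn F b c 0) r) :
    ∃ ρ, r = ρ + 1 ∧ (∀ i < ρ, shiftedRow F c lam i ⬝ᵥ b = 0) ∧
      shiftedRow F c lam ρ ⬝ᵥ b ≠ 0 := by
  obtain ⟨hH, hdeg⟩ := h
  have hN := numer_ne_zero F b c hH
  have hχ := F.charpoly_monic.ne_zero
  have hn : 0 < n := by
    rcases Nat.eq_zero_or_pos n with rfl | h
    · exact absurd (by simp [numer, dotProduct]) hN
    · exact h
  have hinj := RatFunc.algebraMap_injective ℝ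
  rw [transferFn_eq_numer_div, RatFunc.intDegree_div
    ((map_ne_zero_iff _ hinj).2 hN) ((map_ne_zero_iff _ hinj).2 hχ),
    RatFunc.intDegree_polynomial, RatFunc.intDegree_polynomial,
    Matrix.charpoly_natDegree_eq_dim, Fintype.card_fin] at hdeg
  have hlt := natDegree_numer_lt F b hn c
  have hX : ∀ j, ((X + C lam) ^ j * numer F b c).natDegree = j + (numer F b c).natDegree := by
    intro j
    rw [natDegree_mul (pow_ne_zero _ (X_add_C_ne_zero lam)) hN, natDegree_pow, natDegree_X_add_C,
      mul_one]
  obtain ⟨ρ, rfl⟩ : ∃ ρ, r = ρ + 1 := ⟨r - 1, by omega⟩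
  -- The numerator has degree n - 1 - ρ. The i-th parameter is the coefficient of p^(n-1) in (p +
  -- λ)^i times the numerator, so it is beyond the degree for i < ρ and is the leading coefficient
  -- for i = ρ.
  have hz : ∀ i < ρ, HOT.shiftedRow F c lam i ⬝ᵥ b = 0 := by
    intro i
    induction i using Nat.strong_induction_on with
    | _ i ih =>
      intro hi
      rw [← numer_coeff F b hn, numer_shiftedRow F b c lam i fun j hj => ih j hj (by omega)]
      refine coeff_eq_zero_of_natDegree_lt ?_
      rw [hX]
      omega
  refine ⟨ρ, rfl, hz, ?_⟩
  rw [← numer_coeff F b hn, numer_shiftedRow F b c lam ρ hz,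
    show n - 1 = ((X + C lam) ^ ρ * numer F b c).natDegree by rw [hX]; omega]
  exact leadingCoeff_ne_zero.2 (mul_ne_zero (pow_ne_zero _ (X_add_C_ne_zero lam)) hN)

theorem det_add_vecMulVec_of_ne_zero {K : Type*} [Field K] (A : Matrix (Fin n) (Fin n) K)
    (hA : A.det ≠ 0) (u v : Fin n → K) :
    (A + vecMulVec u v).det = A.det + v ⬝ᵥ (A.adjugate *ᵥ u) := by
  have hu := isUnit_iff_ne_zero.2 hA
  have h1 : A + vecMulVec u v =
      A * (1 + replicateCol Unit (A⁻¹ *ᵥ u) * replicateRow Unit v) := by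
    rw [← vecMulVec_eq, Matrix.mul_add, Matrix.mul_one, Matrix.mul_vecMulVec,
      Matrix.mulVec_mulVec, Matrix.mul_nonsing_inv _ hu, Matrix.one_mulVec]
  rw [h1, det_mul, det_one_add_replicateCol_mul_replicateRow, mul_add, mul_one, Matrix.inv_def,
    Matrix.smul_mulVec, dotProduct_smul, Ring.inverse_eq_inv', smul_eq_mul,
    mul_inv_cancel_left₀ hA]

/-- The factorization A + uvᵀ = A(1 + A⁻¹uvᵀ) needs an inverse, so the identity is proved over the
fraction field and pulled back. The case of interest is the characteristic matrix, whose determinant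
is nonzero but need not be a unit in ℝ[p]. -/
theorem det_add_vecMulVec {R : Type*} [CommRing R] [IsDomain R] (A : Matrix (Fin n) (Fin n) R)
    (hA : A.det ≠ 0) (u v : Fin n → R) :
    (A + vecMulVec u v).det = A.det + v ⬝ᵥ (A.adjugate *ᵥ u) := by
  have hinj := IsFractionRing.injective R (FractionRing R)
  set φ := algebraMap R (FractionRing R)
  refine hinj ?_
  have h := det_add_vecMulVec_of_ne_zero (φ.mapMatrix A)
    (by rw [← RingHom.map_det]; exact (map_ne_zero_iff _ hinj).2 hA)
    (fun i => φ (u i)) (fun i => φ (v i))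
  have e : φ.mapMatrix A + vecMulVec (fun i => φ (u i)) (fun i => φ (v i)) =
      φ.mapMatrix (A + vecMulVec u v) := by
    ext i j
    simp [vecMulVec_apply]
  rw [e, ← RingHom.map_det, ← RingHom.map_det, ← RingHom.map_adjugate] at h
  rw [h]
  simp [dotProduct, Matrix.mulVec, map_sum]

theorem charpoly_sub_vecMulVec (v : Fin n → ℝ) :
    (F - vecMulVec b v).charpoly = F.charpoly + numer F b v := by
  have h : (F - vecMulVec b v).charmatrix =
      F.charmatrix + vecMulVec (fun i => C (b i)) (fun i => C (v i)) := by
    ext1 i j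
    by_cases hij : i = j
    · subst hij
      simp [Matrix.charmatrix_apply_eq, vecMulVec_apply]
      ring
    · simp [Matrix.charmatrix_apply_ne, hij, vecMulVec_apply]
      ring
  rw [Matrix.charpoly, h, det_add_vecMulVec _ F.charpoly_monic.ne_zero]
  rfl

/-- The realization need not be minimal. A zero of the unreduced numerator is either a zero of H or
has been cancelled against an eigenvalue of F; both lie in the open left half-plane. -/
theorem hurwitzPoly_numer (hF : HurwitzMatrix F) (hH : transferFn F b c 0 ≠ 0)
    (hmp : MinimumPhase (transferFn F b c 0)) : HurwitzPoly (numer F b c) := by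
  refine ⟨numer_ne_zero F b c hH, fun z hz => ?_⟩
  have h1 := (RatFunc.num_mul_eq_mul_denom_iff (x := transferFn F b c 0)
    F.charpoly_monic.ne_zero).2 (transferFn_eq_numer_div F b c)
  have h2 := congrArg (aeval z) h1
  rw [map_mul, map_mul, hz, zero_mul, mul_eq_zero] at h2
  exact h2.elim (hmp.2 z) (hF.2 z)

/-- Inverting a minimum phase filter of relative degree `ρ` by means of the output
`(p + lam)^(ρ + 1) H` results in a stable system. -/
theorem hurwitzMatrix_inverse (hF : HurwitzMatrix F) (hH : transferFn F b c 0 ≠ 0)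
    (hmp : MinimumPhase (transferFn F b c 0)) (hlam : 0 < lam) {ρ : ℕ}
    (h0 : ∀ i < ρ, shiftedRow F c lam i ⬝ᵥ b = 0) (hκ : shiftedRow F c lam ρ ⬝ᵥ b ≠ 0) :
    HurwitzMatrix (F - vecMulVec b
      ((shiftedRow F c lam ρ ⬝ᵥ b)⁻¹ • shiftedRow F c lam (ρ + 1))) := by
  set κ := shiftedRow F c lam ρ ⬝ᵥ b with hκdef
  have hsm : numer F b (κ⁻¹ • shiftedRow F c lam (ρ + 1)) =
      C κ⁻¹ * numer F b (shiftedRow F c lam (ρ + 1)) := by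
    rw [numer, numer, ← smul_eq_mul, ← smul_dotProduct]
    congr 1
    ext1 i
    simp
  -- The feedback adds κ⁻¹ times the numerator of row ρ + 1. By `numer_shift` that numerator
  -- contains -κχ, which cancels the original characteristic polynomial χ.
  have hχ : (F - vecMulVec b (κ⁻¹ • shiftedRow F c lam (ρ + 1))).charpoly =
      C κ⁻¹ * ((X + C lam) ^ (ρ + 1) * numer F b c) := by
    rw [charpoly_sub_vecMulVec, hsm, shiftedRow, numer_shift, numer_shiftedRow F b c lam ρ h0,
      ← hκdef]
    have : C κ⁻¹ * C κ = 1 := by rw [← C_mul, inv_mul_cancel₀ hκ, C_1]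
    linear_combination (-F.charpoly) * this
  refine ⟨(Matrix.charpoly_monic _).ne_zero, fun z hz => ?_⟩
  rw [hχ] at hz
  simp only [map_mul, map_pow, map_add, aeval_X, aeval_C, mul_eq_zero] at hz
  rcases hz with hz | hz | hz
  · exact absurd hz (by simpa using hκ)
  · have := eq_neg_of_add_eq_zero_left (pow_eq_zero_iff (Nat.succ_ne_zero ρ) |>.1 hz)
    rw [this]
    simpa using hlam
  · exact (hurwitzPoly_numer F b c hF hH hmp).2 z hz

/-- The static gain of a filter with transfer function `α(0) / α(p)` is one. -/
theorem static_gain {α : ℝ[X]} (hα : HurwitzPoly α) (hdet : IsUnit F.det)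
    (h : transferFn F b c 0 = RatFunc.C (α.eval 0) / algebraMap ℝ[X] (RatFunc ℝ) α) :
    c ⬝ᵥ (F⁻¹ *ᵥ b) = -1 := by
  have hinj := RatFunc.algebraMap_injective ℝ
  have hα0 : α.eval 0 ≠ 0 := by
    intro h0
    have := hα.2 0 (by
      rw [← Complex.ofReal_zero, ← Complex.coe_algebraMap, aeval_algebraMap_apply]
      simp [h0])
    simp at this
  rw [transferFn_eq_numer_div, div_eq_div_iff ((map_ne_zero_iff _ hinj).2
    F.charpoly_monic.ne_zero) ((map_ne_zero_iff _ hinj).2 hα.1), ← RatFunc.algebraMap_C,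
    ← map_mul, ← map_mul] at h
  have h1 := congrArg (eval 0) (hinj h)
  simp only [eval_mul, eval_C] at h1
  rw [mul_comm] at h1
  have h2 := mul_left_cancel₀ hα0 h1
  -- At p = 0 the characteristic matrix is -F, so unit gain reads cᵀ(-F)⁻¹b = 1; this is the source
  -- of the minus sign.
  have hev : (evalRingHom (0 : ℝ)).mapMatrix F.charmatrix = -F := by
    ext i j
    by_cases hij : i = j
    · subst hij
      simp [Matrix.charmatrix_apply_eq]
    · simp [Matrix.charmatrix_apply_ne, hij]
  have h3 : eval 0 (numer F b c) = c ⬝ᵥ ((-F).adjugate *ᵥ b) := by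
    rw [← hev, ← RingHom.map_adjugate]
    simp [numer, dotProduct, Matrix.mulVec, eval_finsetSum]
  have h4 : eval 0 F.charpoly = (-F).det := by
    rw [← hev, ← RingHom.map_det]
    rfl
  have h5 : IsUnit (-F).det := by
    rw [Matrix.det_neg]
    exact (isUnit_one.neg.pow _).mul hdet
  have h6 : (-F).adjugate *ᵥ b = (-F).det • -(F⁻¹ *ᵥ b) := by
    have hb : b = (-F) *ᵥ -(F⁻¹ *ᵥ b) := by
      rw [Matrix.neg_mulVec_neg, Matrix.mulVec_mulVec, Matrix.mul_nonsing_inv _ hdet,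
        Matrix.one_mulVec]
    conv_lhs => rw [hb]
    rw [Matrix.mulVec_mulVec, Matrix.adjugate_mul, Matrix.smul_mulVec, Matrix.one_mulVec]
  rw [h3, h4, h6, dotProduct_smul, smul_eq_mul, dotProduct_neg] at h2
  have h7 := mul_left_cancel₀ h5.ne_zero (h2.trans (mul_one _).symm)
  linarith

end Transfer

/-! ### Signals with a prescribed number of bounded derivatives. -/

section Smooth

/-- Signals with `k` bounded derivatives on `[0, ∞)`. -/
def SmoothBounded : ℕ → (ℝ → ℝ) → Prop
  | 0, f => BoundedSignal f
  | k + 1, f => BoundedSignal f ∧ ∃ f', DerivOnIci f f' ∧ SmoothBounded k f'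

theorem SmoothBounded.boundedSignal {k : ℕ} {f : ℝ → ℝ} (h : SmoothBounded k f) :
    BoundedSignal f := by
  cases k with
  | zero => exact h
  | succ k => exact h.1

theorem SmoothBounded.of_succ {k : ℕ} {f : ℝ → ℝ} (h : SmoothBounded (k + 1) f) :
    SmoothBounded k f := by
  induction k generalizing f with
  | zero => exact h.1
  | succ k ih =>
    obtain ⟨h0, f', hf', h1⟩ := h
    exact ⟨h0, f', hf', ih h1⟩

theorem SmoothBounded.mono {k j : ℕ} {f : ℝ → ℝ} (h : SmoothBounded k f) (hj : j ≤ k) :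
    SmoothBounded j f := by
  induction k, hj using Nat.le_induction with
  | base => exact h
  | succ k _ ih => exact ih h.of_succ

theorem SmoothBounded.congr {k : ℕ} {f g : ℝ → ℝ} (h : SmoothBounded k f)
    (hg : ∀ t, 0 ≤ t → g t = f t) : SmoothBounded k g := by
  cases k with
  | zero => exact BoundedSignal.congr h hg
  | succ k =>
    obtain ⟨h0, f', hf', h1⟩ := h
    exact ⟨h0.congr hg, f', hf'.congr hg, h1⟩

theorem SmoothBounded.const (k : ℕ) (c : ℝ) : SmoothBounded k fun _ => c := by
  induction k generalizing c with
  | zero => exact BoundedSignal.const c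
  | succ k ih => exact ⟨BoundedSignal.const c, _, DerivOnIci.const c, ih 0⟩

theorem SmoothBounded.add {k : ℕ} {f g : ℝ → ℝ} (hf : SmoothBounded k f)
    (hg : SmoothBounded k g) : SmoothBounded k fun t => f t + g t := by
  induction k generalizing f g with
  | zero => exact BoundedSignal.add hf hg
  | succ k ih =>
    obtain ⟨hf0, f', hf', hf1⟩ := hf
    obtain ⟨hg0, g', hg', hg1⟩ := hg
    exact ⟨hf0.add hg0, _, hf'.add hg', ih hf1 hg1⟩

theorem SmoothBounded.mul {k : ℕ} {f g : ℝ → ℝ} (hf : SmoothBounded k f)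
    (hg : SmoothBounded k g) : SmoothBounded k fun t => f t * g t := by
  induction k generalizing f g with
  | zero => exact BoundedSignal.mul hf hg
  | succ k ih =>
    have hf2 := hf.of_succ
    have hg2 := hg.of_succ
    obtain ⟨hf0, f', hf', hf1⟩ := hf
    obtain ⟨hg0, g', hg', hg1⟩ := hg
    exact ⟨hf0.mul hg0, _, hf'.mul hg', (ih hf1 hg2).add (ih hf2 hg1)⟩

theorem SmoothBounded.const_mul {k : ℕ} {f : ℝ → ℝ} (c : ℝ) (hf : SmoothBounded k f) :
    SmoothBounded k fun t => c * f t :=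
  (SmoothBounded.const k c).mul hf

theorem SmoothBounded.sub {k : ℕ} {f g : ℝ → ℝ} (hf : SmoothBounded k f)
    (hg : SmoothBounded k g) : SmoothBounded k fun t => f t - g t :=
  (hf.add (hg.const_mul (-1))).congr fun t _ => by ring

theorem SmoothBounded.sum {k : ℕ} {ι : Type*} {s : Finset ι} {f : ι → ℝ → ℝ}
    (h : ∀ i ∈ s, SmoothBounded k (f i)) : SmoothBounded k fun t => ∑ i ∈ s, f i t := by
  classical
  induction s using Finset.induction_on with
  | empty => simpa using SmoothBounded.const k 0
  | insert a s ha ih =>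
    simp only [Finset.sum_insert ha]
    exact (h a (Finset.mem_insert_self _ _)).add
      (ih fun i hi => h i (Finset.mem_insert_of_mem hi))

/-- Bootstrap: a bounded solution of (p + λ)f = g is one derivative smoother than g, because each
derivative already gained for f feeds back into f'. -/
theorem SmoothBounded.of_derivOnIci_sub {k : ℕ} {lam : ℝ} {f g : ℝ → ℝ} (hb : BoundedSignal f)
    (hf : DerivOnIci f fun t => g t - lam * f t) (hg : SmoothBounded k g) :
    SmoothBounded (k + 1) f := by
  induction k with
  | zero => exact ⟨hb, _, hf, SmoothBounded.sub (k := 0) hg (SmoothBounded.const_mul lam hb)⟩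
  | succ k ih => exact ⟨hb, _, hf, hg.sub ((ih hg.of_succ).const_mul lam)⟩

theorem smoothBounded_of_linear {n : ℕ} {F : Matrix (Fin n) (Fin n) ℝ} {z : ℝ → Fin n → ℝ}
    (hz : DerivOnIci z fun t => F *ᵥ z t) (hb : BoundedSignal z) (k : ℕ) (a : Fin n → ℝ) :
    SmoothBounded k fun t => a ⬝ᵥ z t := by
  induction k generalizing a with
  | zero => exact (BoundedSignal.const a).dotProduct hb
  | succ k ih =>
    refine ⟨(BoundedSignal.const a).dotProduct hb, _, hz.dotProduct a, ?_⟩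
    simpa only [Matrix.dotProduct_mulVec] using ih (a ᵥ* F)

end Smooth

/-! ### The chain of outputs (p + λ)^(j+1) H[u]. -/

section FilterChain

variable {n : ℕ} (F : Matrix (Fin n) (Fin n) ℝ) (b c : Fin n → ℝ) (lam : ℝ)
  {z d : ℝ → Fin n → ℝ} {u : ℝ → ℝ} {ρ : ℕ}

/-- The output `(p + lam)^(j+1) cᵀ (p I - F)⁻¹ b [u]` of a filter with state `z`, when its
relative degree exceeds `j`. -/
noncomputable def chainOutput (z : ℝ → Fin n → ℝ) (u : ℝ → ℝ) (j : ℕ) (t : ℝ) : ℝ :=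
  shiftedRow F c lam (j + 1) ⬝ᵥ z t + (shiftedRow F c lam j ⬝ᵥ b) * u t

/-- While the j-th parameter vanishes, u does not enter the j-th output directly, so that output is
differentiable and p + λ takes it to the next one. The perturbation d of the state equation allows
for time-varying coefficients later. -/
theorem derivOnIci_chainOutput (hz : DerivOnIci z fun t => F *ᵥ z t + u t • b + d t) {j : ℕ}
    (hj : shiftedRow F c lam j ⬝ᵥ b = 0) :
    DerivOnIci (chainOutput F b c lam z u j) fun t =>
      chainOutput F b c lam z u (j + 1) t - lam * chainOutput F b c lam z u j t +
        shiftedRow F c lam (j + 1) ⬝ᵥ d t := by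
  have h1 : ∀ t, chainOutput F b c lam z u j t = shiftedRow F c lam (j + 1) ⬝ᵥ z t := fun t => by
    rw [chainOutput, hj, zero_mul, add_zero]
  refine ((hz.dotProduct (shiftedRow F c lam (j + 1))).congr fun t _ => h1 t).congr_deriv
    fun t _ => ?_
  rw [h1 t, chainOutput, shiftedRow.eq_2 F c lam (j + 1), add_dotProduct, dotProduct_add,
    dotProduct_add, dotProduct_smul, smul_dotProduct, Matrix.mulVec_transpose,
    ← Matrix.dotProduct_mulVec]
  simp only [smul_eq_mul]
  ring

theorem boundedSignal_chainOutput (hz : BoundedSignal z) (hu : BoundedSignal u) (j : ℕ) :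
    BoundedSignal (chainOutput F b c lam z u j) :=
  ((BoundedSignal.const _).dotProduct hz).add ((BoundedSignal.const _).mul hu)

/-- Induction down the chain: output ρ is merely bounded, and each inversion of p + λ on the way to
output 0 gains a derivative. No smoothness of u is needed. -/
theorem smoothBounded_chainOutput (hz : DerivOnIci z fun t => F *ᵥ z t + u t • b)
    (h0 : ∀ i < ρ, shiftedRow F c lam i ⬝ᵥ b = 0) (hzb : BoundedSignal z)
    (hub : BoundedSignal u) (k j : ℕ) (hkj : j + k = ρ) :
    SmoothBounded k (chainOutput F b c lam z u j) := by
  induction k generalizing j with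
  | zero => exact boundedSignal_chainOutput F b c lam hzb hub j
  | succ k ih =>
    have hd := derivOnIci_chainOutput F b c lam (d := fun _ => 0)
      (hz.congr_deriv fun t _ => (add_zero _).symm) (h0 j (by omega))
    refine SmoothBounded.of_derivOnIci_sub (lam := lam) (boundedSignal_chainOutput F b c lam hzb hub j)
      (hd.congr_deriv fun t _ => ?_) (ih (j + 1) (by omega))
    rw [dotProduct_zero, add_zero]

/-- Induction up the chain, in the opposite direction: every application of p + λ costs one
derivative of the given output. -/
theorem smoothBounded_chainOutput_of_output (hz : DerivOnIci z fun t => F *ᵥ z t + u t • b)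
    (h0 : ∀ i < ρ, shiftedRow F c lam i ⬝ᵥ b = 0)
    (hv : SmoothBounded ρ (chainOutput F b c lam z u 0)) (k j : ℕ) (hkj : j + k = ρ) :
    SmoothBounded k (chainOutput F b c lam z u j) := by
  induction j generalizing k with
  | zero => exact hv.mono (by omega)
  | succ j ih =>
    have h1 := ih (k + 1) (by omega)
    have h2 := h1.of_succ
    obtain ⟨-, f', hf', h3⟩ := h1
    have hd := derivOnIci_chainOutput F b c lam (d := fun _ => 0)
      (hz.congr_deriv fun t _ => (add_zero _).symm) (h0 j (by omega))
    refine (h3.add (h2.const_mul lam)).congr fun t ht => ?_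
    rw [hf'.unique hd ht, dotProduct_zero]
    ring

/-- The state equation of a filter, with the input expressed by its last chain output. -/
theorem derivOnIci_inverse (hz : DerivOnIci z fun t => F *ᵥ z t + u t • b + d t)
    (hκ : shiftedRow F c lam ρ ⬝ᵥ b ≠ 0) :
    DerivOnIci z fun t => (F - vecMulVec b
      ((shiftedRow F c lam ρ ⬝ᵥ b)⁻¹ • shiftedRow F c lam (ρ + 1))) *ᵥ z t +
      (((shiftedRow F c lam ρ ⬝ᵥ b)⁻¹ * chainOutput F b c lam z u ρ t) • b + d t) := by
  refine hz.congr_deriv fun t _ => ?_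
  rw [Matrix.sub_mulVec, chainOutput, mul_add, inv_mul_cancel_left₀ hκ, add_smul]
  have : vecMulVec b ((shiftedRow F c lam ρ ⬝ᵥ b)⁻¹ • shiftedRow F c lam (ρ + 1)) *ᵥ z t =
      ((shiftedRow F c lam ρ ⬝ᵥ b)⁻¹ * (shiftedRow F c lam (ρ + 1) ⬝ᵥ z t)) • b := by
    rw [Matrix.vecMulVec_mulVec, smul_dotProduct, op_smul_eq_smul, smul_eq_mul]
  rw [this]
  abel

theorem input_eq (hκ : shiftedRow F c lam ρ ⬝ᵥ b ≠ 0) (t : ℝ) :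
    u t = (shiftedRow F c lam ρ ⬝ᵥ b)⁻¹ *
      (chainOutput F b c lam z u ρ t - shiftedRow F c lam (ρ + 1) ⬝ᵥ z t) := by
  rw [chainOutput, add_sub_cancel_left, inv_mul_cancel_left₀ hκ]

end FilterChain

/-! ### Lyapunov analysis of the high-order tuner. -/

section Tuner

theorem DerivOnIci.quadratic {q : ℕ} {P : Matrix (Fin q) (Fin q) ℝ} (hP : Pᵀ = P)
    {z z' : ℝ → Fin q → ℝ} (h : DerivOnIci z z') :
    DerivOnIci (fun t => 1 / 2 * (z t ⬝ᵥ (P *ᵥ z t))) (fun t => z t ⬝ᵥ (P *ᵥ z' t)) := by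
  have h1 : DerivOnIci (fun t => z t ⬝ᵥ (P *ᵥ z t))
      (fun t => ∑ i, (z' t i * (P *ᵥ z t) i + z t i * (P *ᵥ z' t) i)) :=
    DerivOnIci.sum fun i _ => (derivOnIci_pi.1 h i).mul (h.dotProduct (P i))
  refine (h1.const_mul (1 / 2)).congr_deriv fun t _ => ?_
  rw [Finset.sum_add_distrib]
  change 1 / 2 * (z' t ⬝ᵥ (P *ᵥ z t) + z t ⬝ᵥ (P *ᵥ z' t)) = _
  rw [show z' t ⬝ᵥ (P *ᵥ z t) = z t ⬝ᵥ (P *ᵥ z' t) by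
    rw [Matrix.dotProduct_mulVec, ← Matrix.mulVec_transpose, hP, dotProduct_comm]]
  ring

theorem dotProduct_mulVec_lyapunov {q : ℕ} {Γ P : Matrix (Fin q) (Fin q) ℝ} (hP : Pᵀ = P)
    (hLyap : Γᵀ * P + P * Γ = -(2 : ℝ) • (1 : Matrix (Fin q) (Fin q) ℝ)) (v : Fin q → ℝ) :
    v ⬝ᵥ (P *ᵥ (Γ *ᵥ v)) = -(v ⬝ᵥ v) := by
  have h1 := congrArg (fun M => v ⬝ᵥ (M *ᵥ v)) hLyap
  simp only [Matrix.add_mulVec, Matrix.smul_mulVec, Matrix.one_mulVec, dotProduct_add,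
    dotProduct_smul, smul_eq_mul, ← Matrix.mulVec_mulVec] at h1
  have h2 : v ⬝ᵥ (Γᵀ *ᵥ (P *ᵥ v)) = v ⬝ᵥ (P *ᵥ (Γ *ᵥ v)) := by
    rw [Matrix.dotProduct_mulVec, Matrix.vecMul_transpose, Matrix.dotProduct_mulVec,
      ← Matrix.mulVec_transpose, hP, dotProduct_comm]
  linarith

/-- A kernel vector v of Γ would satisfy 0 = vᵀPΓv = -|v|². -/
theorem isUnit_det_of_lyapunov {q : ℕ} {Γ P : Matrix (Fin q) (Fin q) ℝ} (hP : Pᵀ = P)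
    (hLyap : Γᵀ * P + P * Γ = -(2 : ℝ) • (1 : Matrix (Fin q) (Fin q) ℝ)) : IsUnit Γ.det := by
  rw [isUnit_iff_ne_zero]
  intro h0
  obtain ⟨v, hv, hΓ⟩ := Matrix.exists_mulVec_eq_zero_iff.2 h0
  have h1 := dotProduct_mulVec_lyapunov hP hLyap v
  rw [hΓ, Matrix.mulVec_zero, dotProduct_zero, zero_eq_neg] at h1
  exact hv (dotProduct_self_eq_zero.1 h1)

/-- A quadratic form given by a positive definite matrix bounds the coordinates. -/
theorem exists_abs_le_of_posDef {q : ℕ} {P : Matrix (Fin q) (Fin q) ℝ} (hP : P.PosDef)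
    (j : Fin q) : ∃ K : ℝ, ∀ v : Fin q → ℝ, |v j| ≤ v ⬝ᵥ (P *ᵥ v) + K := by
  have hsym : Pᵀ = P := by simpa using hP.isHermitian.eq
  have hu : IsUnit P.det := isUnit_iff_ne_zero.2 hP.det_pos.ne'
  set w := P⁻¹ *ᵥ Pi.single j 1 with hw
  have hPw : P *ᵥ w = Pi.single j 1 := by
    rw [hw, Matrix.mulVec_mulVec, Matrix.mul_nonsing_inv _ hu, Matrix.one_mulVec]
  have hnn : ∀ x : Fin q → ℝ, 0 ≤ x ⬝ᵥ (P *ᵥ x) := fun x => by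
    simpa using hP.posSemidef.dotProduct_mulVec_nonneg x
  have hcomm : ∀ v, w ⬝ᵥ (P *ᵥ v) = v j := fun v => by
    rw [Matrix.dotProduct_mulVec, ← Matrix.mulVec_transpose, hsym, hPw, single_one_dotProduct]
  refine ⟨|w j|, fun v => ?_⟩
  -- Since Pw is the j-th unit vector, expanding the form at v ± w gives 2|vⱼ| ≤ vᵀPv + wⱼ.
  have h1 := hnn (v - w)
  have h2 := hnn (v + w)
  simp only [Matrix.mulVec_sub, Matrix.mulVec_add, dotProduct_sub, dotProduct_add, sub_dotProduct,
    add_dotProduct, hcomm, hPw, dotProduct_single_one, Pi.sub_apply, Pi.add_apply] at h1 h2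
  have h3 := hnn v
  have h4 := le_abs_self (w j)
  have h6 := neg_abs_le (w j)
  have h5 := abs_nonneg (w j)
  rw [abs_le]
  constructor <;> linarith

theorem dotProduct_sq_le {q : ℕ} (v w : Fin q → ℝ) : (v ⬝ᵥ w) ^ 2 ≤ (v ⬝ᵥ v) * (w ⬝ᵥ w) := by
  simpa only [dotProduct, sq] using Finset.sum_mul_sq_le_sq_mul_sq Finset.univ v w

theorem dotProduct_self_eq_norm_sq {q : ℕ} (v : Fin q → ℝ) :
    v ⬝ᵥ v = ‖WithLp.toLp 2 v‖ ^ 2 := by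
  rw [EuclideanSpace.norm_sq_eq]
  simp [dotProduct, sq]

theorem Dissipated.of_derivOnIci {f V V' : ℝ → ℝ} (hV : DerivOnIci V V')
    (h0 : ∀ t, 0 ≤ t → 0 ≤ V t) {a : ℝ} (ha : 0 < a)
    (h : ∀ t, 0 ≤ t → V' t ≤ -(a * f t ^ 2)) : Dissipated f := by
  refine ⟨_, _, hV.const_mul a⁻¹, fun t ht => ⟨by have := h0 t ht; positivity, ?_⟩⟩
  calc a⁻¹ * V' t ≤ a⁻¹ * -(a * f t ^ 2) := by gcongr; exact h t ht
    _ = -‖f t‖ ^ 2 := by rw [Real.norm_eq_abs, sq_abs]; field_simp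

/-- The decay estimate for the Lyapunov function of the error model. -/
theorem tuner_decay {m q : ℕ} {Γ P : Matrix (Fin q) (Fin q) ℝ} {l p : Fin q → ℝ}
    {μ lam : ℝ} (hP : Pᵀ = P)
    (hLyap : Γᵀ * P + P * Γ = -(2 : ℝ) • (1 : Matrix (Fin q) (Fin q) ℝ)) (hlam : 0 < lam)
    (hμ : μ > 3 / (4 * lam) * (‖WithLp.toLp 2 l‖ + ‖WithLp.toLp 2 (P *ᵥ p)‖) ^ 2)
    (e ε U' : ℝ) (hU : U' ≤ -‖ε‖ ^ 2) (ϖ θ ψ : Fin m → ℝ) (η : Fin m → Fin q → ℝ) :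
    e * (-lam * e + ϖ ⬝ᵥ (θ - (ψ + fun i => l ⬝ᵥ η i)) + ε) +
        ∑ i, (θ i - ψ i) * (-(e * ϖ i)) +
        ∑ i, η i ⬝ᵥ (P *ᵥ ((1 + μ * (ϖ ⬝ᵥ ϖ)) • (Γ *ᵥ η i) + (ϖ i * e) • p)) +
        3 / (4 * lam) * U' ≤ -(lam / 3 * e ^ 2 + ∑ i, η i ⬝ᵥ η i) := by
  set N := ‖WithLp.toLp 2 l‖ + ‖WithLp.toLp 2 (P *ᵥ p)‖ with hN
  have hμ0 : 0 < μ := lt_of_le_of_lt (by positivity) hμ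
  -- The gain condition is the discriminant condition for λe²/3 - eB + μGH ≥ 0. The damping λe² is
  -- split into thirds: one for this coupling, one for ε, one left as decay.
  have hNμ : N ^ 2 ≤ 4 * (lam / 3) * μ := by
    have h1 : 3 / (4 * lam) * N ^ 2 * (4 * lam / 3) = N ^ 2 := by field_simp
    nlinarith [mul_le_mul_of_nonneg_right hμ.le (by positivity : 0 ≤ 4 * lam / 3)]
  set G := ϖ ⬝ᵥ ϖ with hG
  set H := ∑ i, η i ⬝ᵥ η i with hH
  set B := ∑ i, ϖ i * ((P *ᵥ p - l) ⬝ᵥ η i) with hB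
  have hG0 : 0 ≤ G := Finset.sum_nonneg fun i _ => mul_self_nonneg _
  have hH0 : 0 ≤ H := Finset.sum_nonneg fun i _ => Finset.sum_nonneg fun j _ => mul_self_nonneg _
  have hnorm : (P *ᵥ p - l) ⬝ᵥ (P *ᵥ p - l) ≤ N ^ 2 := by
    rw [dotProduct_self_eq_norm_sq]
    gcongr
    rw [WithLp.toLp_sub, hN, add_comm]
    exact norm_sub_le _ _
  have hBsq : B ^ 2 ≤ N ^ 2 * (G * H) := by
    calc B ^ 2 ≤ G * ∑ i, ((P *ᵥ p - l) ⬝ᵥ η i) ^ 2 := by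
          have := dotProduct_sq_le ϖ fun i => (P *ᵥ p - l) ⬝ᵥ η i
          simpa only [dotProduct, hB, hG, sq] using this
      _ ≤ G * ∑ i, N ^ 2 * (η i ⬝ᵥ η i) := by
          gcongr with i
          refine (dotProduct_sq_le _ _).trans ?_
          gcongr
          exact Finset.sum_nonneg fun j _ => mul_self_nonneg _
      _ = N ^ 2 * (G * H) := by rw [← Finset.mul_sum, ← hH]; ring
  have hcross : e * B ≤ lam / 3 * e ^ 2 + μ * (G * H) := by
    have h1 : B ^ 2 ≤ 4 * (lam / 3) * μ * (G * H) :=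
      hBsq.trans (mul_le_mul_of_nonneg_right hNμ (mul_nonneg hG0 hH0))
    have h2 : 0 ≤ lam / 3 * (lam / 3 * e ^ 2 + μ * (G * H) - e * B) := by
      nlinarith [sq_nonneg (lam / 3 * e - B / 2)]
    have h3 := nonneg_of_mul_nonneg_right h2 (by positivity)
    linarith
  -- The weight 3/(4λ) comes from Young's inequality eε ≤ λe²/3 + 3ε²/(4λ).
  have hεe : e * ε + 3 / (4 * lam) * U' ≤ lam / 3 * e ^ 2 := by
    rw [Real.norm_eq_abs, sq_abs] at hU
    have h1 : 3 / (4 * lam) * U' ≤ 3 / (4 * lam) * -ε ^ 2 := by gcongr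
    have h2 : 0 ≤ 3 / (4 * lam) * (2 * lam / 3 * e - ε) ^ 2 := by positivity
    have h3 : 3 / (4 * lam) * (2 * lam / 3 * e - ε) ^ 2 =
        lam / 3 * e ^ 2 - e * ε + 3 / (4 * lam) * ε ^ 2 := by
      field_simp
      ring
    linarith
  have e1 : ϖ ⬝ᵥ (θ - (ψ + fun i => l ⬝ᵥ η i)) =
      ∑ i, ϖ i * (θ i - ψ i) - ∑ i, ϖ i * (l ⬝ᵥ η i) := by
    rw [← Finset.sum_sub_distrib, dotProduct]
    refine Finset.sum_congr rfl fun i _ => ?_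
    simp only [Pi.sub_apply, Pi.add_apply]
    ring
  have e2 : ∑ i, (θ i - ψ i) * (-(e * ϖ i)) = -e * ∑ i, ϖ i * (θ i - ψ i) := by
    rw [Finset.mul_sum]
    exact Finset.sum_congr rfl fun i _ => by ring
  -- In the factor 1 + μG, the part μG dominates the coupling and the 1 survives as the decay -H.
  have e3 : ∑ i, η i ⬝ᵥ (P *ᵥ ((1 + μ * G) • (Γ *ᵥ η i) + (ϖ i * e) • p)) =
      -(1 + μ * G) * H + e * ∑ i, ϖ i * ((P *ᵥ p) ⬝ᵥ η i) := by
    rw [hH, Finset.mul_sum, Finset.mul_sum, ← Finset.sum_add_distrib]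
    refine Finset.sum_congr rfl fun i _ => ?_
    rw [Matrix.mulVec_add, Matrix.mulVec_smul, Matrix.mulVec_smul, dotProduct_add,
      dotProduct_smul, dotProduct_smul, dotProduct_mulVec_lyapunov hP hLyap,
      dotProduct_comm (P *ᵥ p), smul_eq_mul, smul_eq_mul]
    ring
  have e4 : B = ∑ i, ϖ i * ((P *ᵥ p) ⬝ᵥ η i) - ∑ i, ϖ i * (l ⬝ᵥ η i) := by
    rw [hB, ← Finset.sum_sub_distrib]
    exact Finset.sum_congr rfl fun i _ => by rw [sub_dotProduct]; ring
  rw [e1, e2, e3]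
  rw [e4] at hcross
  linarith

/-- Stability of the error model with a high-order tuner. -/
theorem tuner_stability {m q : ℕ} {Γ P : Matrix (Fin q) (Fin q) ℝ} {l p : Fin q → ℝ}
    {μ lam : ℝ} (hP : P.PosDef)
    (hLyap : Γᵀ * P + P * Γ = -(2 : ℝ) • (1 : Matrix (Fin q) (Fin q) ℝ)) (hlam : 0 < lam)
    (hμ : μ > 3 / (4 * lam) * (‖WithLp.toLp 2 l‖ + ‖WithLp.toLp 2 (P *ᵥ p)‖) ^ 2)
    {θ : Fin m → ℝ} {e ε : ℝ → ℝ} {ϖ ψ : ℝ → Fin m → ℝ} {η : ℝ → Fin m → Fin q → ℝ}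
    (he : DerivOnIci e fun t =>
      -lam * e t + ϖ t ⬝ᵥ (θ - (ψ t + fun i => l ⬝ᵥ η t i)) + ε t)
    (hψ : DerivOnIci ψ fun t => e t • ϖ t)
    (hη : ∀ i, DerivOnIci (fun t => η t i) fun t =>
      (1 + μ * (ϖ t ⬝ᵥ ϖ t)) • (Γ *ᵥ η t i) + (ϖ t i * e t) • p)
    (hε : Dissipated ε) :
    BoundedSignal e ∧ BoundedSignal ψ ∧ BoundedSignal η ∧ Dissipated e ∧
      ∀ i j, Dissipated fun t => η t i j := by
  have hsym : Pᵀ = P := by simpa using hP.isHermitian.eq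
  have hnn : ∀ x : Fin q → ℝ, 0 ≤ x ⬝ᵥ (P *ᵥ x) := fun x => by
    simpa using hP.posSemidef.dotProduct_mulVec_nonneg x
  obtain ⟨U, U', hU, hU'⟩ := hε
  have he2 : DerivOnIci (fun t => 1 / 2 * (e t * e t)) _ := ((he.mul he).const_mul (1 / 2))
  have hψ2 : ∀ i, DerivOnIci (fun t => 1 / 2 * ((θ i - ψ t i) * (θ i - ψ t i)))
      (fun t => (θ i - ψ t i) * (-(e t * ϖ t i))) := fun i =>
    ((((DerivOnIci.const (θ i)).sub (derivOnIci_pi.1 hψ i)).mul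
      ((DerivOnIci.const (θ i)).sub (derivOnIci_pi.1 hψ i))).const_mul (1 / 2)).congr_deriv
      fun t _ => by simp only [Pi.smul_apply, smul_eq_mul]; ring
  have hV := ((he2.add (DerivOnIci.sum (s := Finset.univ) fun i _ => hψ2 i)).add
    (DerivOnIci.sum (s := Finset.univ) fun i _ => (hη i).quadratic hsym)).add
      (hU.const_mul (3 / (4 * lam)))
  set V := fun t => 1 / 2 * (e t * e t) + ∑ i, 1 / 2 * ((θ i - ψ t i) * (θ i - ψ t i)) +
    ∑ i, 1 / 2 * (η t i ⬝ᵥ (P *ᵥ η t i)) + 3 / (4 * lam) * U t with hVdef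
  obtain ⟨V', hV', hle⟩ : ∃ V', DerivOnIci V V' ∧
      ∀ t, 0 ≤ t → V' t ≤ -(lam / 3 * e t ^ 2 + ∑ i, η t i ⬝ᵥ η t i) := by
    refine ⟨_, hV, fun t ht => le_trans (le_of_eq ?_)
      (tuner_decay hsym hLyap hlam hμ (e t) (ε t) (U' t) (hU' t ht).2 (ϖ t) θ (ψ t) (η t))⟩
    ring
  have hη0 : ∀ t, 0 ≤ ∑ i, η t i ⬝ᵥ η t i := fun t =>
    Finset.sum_nonneg fun i _ => Finset.sum_nonneg fun j _ => mul_self_nonneg _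
  have hanti := hV'.antitoneOn fun t ht => (hle t ht).trans (by
    nlinarith [sq_nonneg (e t), hη0 t])
  have t1 : ∀ t, 0 ≤ 1 / 2 * (e t * e t) := fun t => by nlinarith [mul_self_nonneg (e t)]
  have t2 : ∀ t i, 0 ≤ 1 / 2 * ((θ i - ψ t i) * (θ i - ψ t i)) := fun t i => by
    nlinarith [mul_self_nonneg (θ i - ψ t i)]
  have t3 : ∀ t i, 0 ≤ 1 / 2 * (η t i ⬝ᵥ (P *ᵥ η t i)) := fun t i => by
    nlinarith [hnn (η t i)]
  have t2' := fun t => Finset.sum_nonneg fun i (_ : i ∈ Finset.univ) => t2 t i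
  have t3' := fun t => Finset.sum_nonneg fun i (_ : i ∈ Finset.univ) => t3 t i
  have t4 : ∀ t, 0 ≤ t → 0 ≤ 3 / (4 * lam) * U t := fun t ht => by
    have := (hU' t ht).1
    positivity
  have hV0 : ∀ t, 0 ≤ t → 0 ≤ V t := fun t ht => by
    simp only [hVdef]
    linarith [t1 t, t2' t, t3' t, t4 t ht]
  have hVle : ∀ t, 0 ≤ t → V t ≤ V 0 := fun t ht => hanti Set.self_mem_Ici ht ht
  refine ⟨?_, ?_, ?_, ?_, fun i j => ?_⟩
  · refine boundedSignal_of_sq_le (C := 2 * V 0) fun t ht => ?_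
    have h1 := hVle t ht
    simp only [hVdef] at h1 ⊢
    rw [Real.norm_eq_abs, sq_abs]
    nlinarith [t2' t, t3' t, t4 t ht]
  · refine boundedSignal_pi.2 fun i => ?_
    have h2 : BoundedSignal fun t => θ i - ψ t i := by
      refine boundedSignal_of_sq_le (C := 2 * V 0) fun t ht => ?_
      have h1 := hVle t ht
      have h3 := Finset.single_le_sum (f := fun i => 1 / 2 * ((θ i - ψ t i) * (θ i - ψ t i)))
        (fun i _ => t2 t i) (Finset.mem_univ i)
      simp only [hVdef] at h1 h3 ⊢
      rw [Real.norm_eq_abs, sq_abs]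
      nlinarith [t1 t, t3' t, t4 t ht]
    exact ((BoundedSignal.const (θ i)).sub h2).congr fun t _ => by ring
  · refine boundedSignal_pi.2 fun i => boundedSignal_pi.2 fun j => ?_
    obtain ⟨K, hK⟩ := exists_abs_le_of_posDef hP j
    refine ⟨2 * V 0 + K, fun t ht => (hK (η t i)).trans ?_⟩
    have h1 := hVle t ht
    have h3 := Finset.single_le_sum (f := fun i => 1 / 2 * (η t i ⬝ᵥ (P *ᵥ η t i)))
      (fun i _ => t3 t i) (Finset.mem_univ i)
    simp only [hVdef] at h1 h3 ⊢
    linarith [t1 t, t2' t, t4 t ht]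
  · refine Dissipated.of_derivOnIci hV' hV0 (a := lam / 3) (by positivity) fun t ht => ?_
    linarith [hle t ht, hη0 t]
  · refine Dissipated.of_derivOnIci hV' hV0 one_pos fun t ht => (hle t ht).trans ?_
    have h1 : η t i j * η t i j ≤ η t i ⬝ᵥ η t i := Finset.single_le_sum
      (f := fun j => η t i j * η t i j) (fun j _ => mul_self_nonneg _) (Finset.mem_univ j)
    have h2 : η t i ⬝ᵥ η t i ≤ ∑ i, η t i ⬝ᵥ η t i := Finset.single_le_sum
      (f := fun i => η t i ⬝ᵥ η t i)
      (fun i _ => Finset.sum_nonneg fun j _ => mul_self_nonneg _) (Finset.mem_univ i)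
    have h3 : 0 ≤ lam / 3 * e t ^ 2 := by positivity
    nlinarith

end Tuner

/-! ### Persistent excitation against a slowly varying vector. -/

section Excitation

/-- Over a window of length T the vector ϑ is almost constant, so f(s)·ϑ(t) is small for all s in
[t, t + T]. Excitation bounds the integral of its square below by α|ϑ(t)|². -/
theorem PersistentlyExciting.tendsto_zero {m : ℕ} {f ϑ ϑ' : ℝ → Fin m → ℝ}
    (hf : PersistentlyExciting f) (hc : ContinuousOn f (Set.Ici 0)) (hϑ : DerivOnIci ϑ ϑ')
    (hϑ' : Tendsto ϑ' atTop (𝓝 0)) (hu : Tendsto (fun t => f t ⬝ᵥ ϑ t) atTop (𝓝 0)) :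
    Tendsto ϑ atTop (𝓝 0) := by
  obtain ⟨-, ⟨C, hC⟩, α, hα, T, hT, hPE⟩ := hf
  have hC0 : 0 ≤ C := (norm_nonneg _).trans (hC 0 le_rfl)
  have hquad : ∀ t, 0 ≤ t → ∀ v : Fin m → ℝ,
      α * (v ⬝ᵥ v) ≤ ∫ s in t..(t + T), (f s ⬝ᵥ v) ^ 2 := by
    intro t ht v
    have h1 := (hPE t ht).dotProduct_mulVec_nonneg v
    rw [Matrix.sub_mulVec, dotProduct_sub, Matrix.smul_mulVec, Matrix.one_mulVec,
      dotProduct_smul, smul_eq_mul, star_trivial, sub_nonneg] at h1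
    refine h1.trans_eq ?_
    have hint : ∀ i j, IntervalIntegrable (fun s => f s i * f s j) MeasureTheory.volume
        t (t + T) := by
      intro i j
      refine ContinuousOn.intervalIntegrable ?_
      have hsub : Set.uIcc t (t + T) ⊆ Set.Ici 0 := by
        rw [Set.uIcc_of_le (by linarith)]
        exact fun s hs => ht.trans hs.1
      exact ((continuousOn_pi.1 hc i).mul (continuousOn_pi.1 hc j)).mono hsub
    have e1 : (fun s => (f s ⬝ᵥ v) ^ 2) =
        fun s => ∑ i, ∑ j, (v i * v j) * (f s i * f s j) := by
      ext s
      rw [sq, dotProduct, Finset.sum_mul_sum]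
      exact Finset.sum_congr rfl fun i _ => Finset.sum_congr rfl fun j _ => by ring
    have hint' : ∀ i, IntervalIntegrable (fun s => ∑ j, (v i * v j) * (f s i * f s j))
        MeasureTheory.volume t (t + T) := fun i => by
      simpa only [Finset.sum_fn] using IntervalIntegrable.sum Finset.univ
        fun j _ => (hint i j).const_mul (v i * v j)
    rw [e1, intervalIntegral.integral_finsetSum fun i _ => hint' i]
    simp only [dotProduct, Matrix.mulVec, Matrix.of_apply, Finset.mul_sum]
    refine Finset.sum_congr rfl fun i _ => ?_
    rw [intervalIntegral.integral_finsetSum fun j _ => (hint i j).const_mul _]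
    refine Finset.sum_congr rfl fun j _ => ?_
    rw [intervalIntegral.integral_const_mul]
    ring
  rw [Metric.tendsto_atTop] at hϑ' hu ⊢
  intro ε hε
  -- Chosen so that κ²T = α(ε/2)². Half of κ is spent on f·ϑ → 0 and half on the drift of ϑ over the
  -- window; the factor m below comes from bounding dot products by sup norms.
  set κ := ε * √(α / (4 * T)) with hκ
  have hκ0 : 0 < κ := by positivity
  obtain ⟨T₁, hT₁⟩ := hu (κ / 2) (by positivity)
  obtain ⟨T₂, hT₂⟩ := hϑ' (κ / 2 / (m * C * T + 1)) (by positivity)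
  refine ⟨max 0 (max T₁ T₂), fun t ht => ?_⟩
  have ht0 : 0 ≤ t := (le_max_left _ _).trans ht
  have ht1 : T₁ ≤ t := (le_max_left _ _).trans ((le_max_right _ _).trans ht)
  have ht2 : T₂ ≤ t := (le_max_right _ _).trans ((le_max_right _ _).trans ht)
  have hdot : ∀ v w : Fin m → ℝ, |v ⬝ᵥ w| ≤ m * ‖v‖ * ‖w‖ := by
    intro v w
    calc |v ⬝ᵥ w| ≤ ∑ i, |v i * w i| := Finset.abs_sum_le_sum_abs _ _
      _ ≤ ∑ _i : Fin m, ‖v‖ * ‖w‖ := Finset.sum_le_sum fun i _ => by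
        rw [abs_mul]
        exact mul_le_mul (norm_le_pi_norm v i) (norm_le_pi_norm w i) (abs_nonneg _)
          (norm_nonneg _)
      _ = m * ‖v‖ * ‖w‖ := by simp [mul_assoc]
  have hbound : ∀ s, t ≤ s → s ≤ t + T → |f s ⬝ᵥ ϑ t| ≤ κ := by
    intro s hs hs'
    have hmv : ‖ϑ t - ϑ s‖ ≤ κ / 2 / (m * C * T + 1) * ‖t - s‖ :=
      Convex.norm_image_sub_le_of_norm_hasDerivWithin_le (s := Set.Ici t) (f' := ϑ')
        (fun x hx => (hϑ x (ht0.trans hx)).mono (Set.Ici_subset_Ici.2 ht0))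
        (fun x hx => by simpa using (hT₂ x (ht2.trans hx)).le) (convex_Ici t) hs
        Set.self_mem_Ici
    have hts : ‖t - s‖ ≤ T := by rw [Real.norm_eq_abs, abs_le]; constructor <;> linarith
    have h1 := hT₁ s (ht1.trans hs)
    rw [dist_zero_right, Real.norm_eq_abs] at h1
    have h2 : |f s ⬝ᵥ (ϑ t - ϑ s)| ≤ κ / 2 := by
      calc |f s ⬝ᵥ (ϑ t - ϑ s)| ≤ m * ‖f s‖ * ‖ϑ t - ϑ s‖ := hdot _ _
        _ ≤ m * C * (κ / 2 / (m * C * T + 1) * T) := by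
          gcongr
          · exact hC s (ht0.trans hs)
          · exact hmv.trans (by gcongr)
        _ = κ / 2 * (m * C * T / (m * C * T + 1)) := by ring
        _ ≤ κ / 2 * 1 := by
          gcongr
          exact (div_le_one (by positivity)).2 (by linarith)
        _ = κ / 2 := mul_one _
    have h3 : f s ⬝ᵥ ϑ t = f s ⬝ᵥ ϑ s + f s ⬝ᵥ (ϑ t - ϑ s) := by
      rw [dotProduct_sub]; ring
    rw [h3]
    linarith [abs_add_le (f s ⬝ᵥ ϑ s) (f s ⬝ᵥ (ϑ t - ϑ s))]
  have hI : ∫ s in t..(t + T), (f s ⬝ᵥ ϑ t) ^ 2 ≤ κ ^ 2 * T := by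
    have := intervalIntegral.norm_integral_le_of_norm_le_const (a := t) (b := t + T)
      (C := κ ^ 2) (f := fun s => (f s ⬝ᵥ ϑ t) ^ 2) fun s hs => by
        rw [Set.uIoc_of_le (by linarith)] at hs
        rw [Real.norm_eq_abs, abs_pow]
        have := hbound s hs.1.le hs.2
        gcongr
    rw [add_sub_cancel_left, abs_of_pos hT] at this
    exact (le_abs_self _).trans this
  have h4 := (hquad t ht0 (ϑ t)).trans hI
  have h5 : κ ^ 2 * T = α * (ε / 2) ^ 2 := by
    rw [hκ, mul_pow, Real.sq_sqrt (by positivity)]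
    field_simp
    norm_num
  rw [h5] at h4
  have h6 : ϑ t ⬝ᵥ ϑ t ≤ (ε / 2) ^ 2 := le_of_mul_le_mul_left h4 hα
  rw [dist_zero_right]
  refine lt_of_le_of_lt ((pi_norm_le_iff_of_nonneg (by positivity)).2 fun i => ?_)
    (half_lt_self hε)
  refine abs_le_of_sq_le_sq ?_ (by positivity)
  refine le_trans ?_ h6
  rw [sq]
  exact Finset.single_le_sum (f := fun i => ϑ t i * ϑ t i) (fun i _ => mul_self_nonneg _)
    (Finset.mem_univ i)

end Excitation

/-! ### Filters combined with slowly varying coefficients. -/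

section Combination

variable {n m : ℕ} {F : Matrix (Fin n) (Fin n) ℝ} {b : Fin n → ℝ} (c : Fin n → ℝ) (lam : ℝ)
  {ϑ ϑ' f : ℝ → Fin m → ℝ} {z : ℝ → Fin m → Fin n → ℝ} {ρ : ℕ}

/-- The state equation of a combination, with time-varying coefficients, of copies of a filter. -/
theorem derivOnIci_combination
    (hz : ∀ i, DerivOnIci (fun t => z t i) fun t => F *ᵥ z t i + f t i • b)
    (hϑ : DerivOnIci ϑ ϑ') :
    DerivOnIci (fun t => ∑ i, ϑ t i • z t i) fun t =>
      F *ᵥ (∑ i, ϑ t i • z t i) + (f t ⬝ᵥ ϑ t) • b + ∑ i, ϑ' t i • z t i := by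
  have h1 := DerivOnIci.sum (s := Finset.univ) fun i _ => (derivOnIci_pi.1 hϑ i).smul (hz i)
  refine h1.congr_deriv fun t _ => ?_
  rw [Matrix.mulVec_sum, dotProduct, Finset.sum_smul, ← Finset.sum_add_distrib,
    ← Finset.sum_add_distrib]
  refine Finset.sum_congr rfl fun i _ => ?_
  rw [Matrix.mulVec_smul, smul_add, smul_smul, mul_comm]

theorem chainOutput_combination (j : ℕ) (t : ℝ) :
    chainOutput F b c lam (fun t => ∑ i, ϑ t i • z t i) (fun t => f t ⬝ᵥ ϑ t) j t =
      ∑ i, ϑ t i * chainOutput F b c lam (fun t => z t i) (fun t => f t i) j t := by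
  simp only [chainOutput]
  rw [dotProduct_sum, show f t ⬝ᵥ ϑ t = ∑ i, f t i * ϑ t i from rfl, Finset.mul_sum,
    ← Finset.sum_add_distrib]
  refine Finset.sum_congr rfl fun i _ => ?_
  rw [dotProduct_smul, smul_eq_mul]
  ring

theorem uniformContinuousOn_dotProduct {f g : ℝ → Fin m → ℝ} (hf : BoundedSignal f)
    (hg : BoundedSignal g) (hfc : ∀ i, UniformContinuousOn (fun t => f t i) (Set.Ici 0))
    (hgc : ∀ i, UniformContinuousOn (fun t => g t i) (Set.Ici 0)) :
    UniformContinuousOn (fun t => f t ⬝ᵥ g t) (Set.Ici 0) :=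
  uniformContinuousOn_finset_sum fun i _ => (boundedSignal_pi.1 hf i).mul_uniformContinuousOn
    (boundedSignal_pi.1 hg i) (hfc i) (hgc i)

theorem uniformContinuousOn_apply {f : ℝ → Fin m → ℝ} (hf : UniformContinuousOn f (Set.Ici 0))
    (i : Fin m) : UniformContinuousOn (fun t => f t i) (Set.Ici 0) :=
  (Pi.uniformContinuous_proj _ i).comp_uniformContinuousOn hf

/-- Supplies the hypothesis of Barbalat's lemma at every stage of the chain. The last stage contains
the input itself, which is why uniform continuity of f is assumed. -/
theorem uniformContinuousOn_chainOutput
    (hz : ∀ i, DerivOnIci (fun t => z t i) fun t => F *ᵥ z t i + f t i • b)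
    (hzb : BoundedSignal z) (hfb : BoundedSignal f) (hfc : UniformContinuousOn f (Set.Ici 0))
    (hϑ : DerivOnIci ϑ ϑ') (hϑb : BoundedSignal ϑ) (hϑb' : BoundedSignal ϑ') (j : ℕ) :
    UniformContinuousOn
      (chainOutput F b c lam (fun t => ∑ i, ϑ t i • z t i) (fun t => f t ⬝ᵥ ϑ t) j)
      (Set.Ici 0) := by
  have hzc : ∀ i, UniformContinuousOn (fun t => z t i) (Set.Ici 0) := fun i =>
    (hz i).uniformContinuousOn (((boundedSignal_pi.1 hzb i).mulVec F).add
      ((boundedSignal_pi.1 hfb i).smul (BoundedSignal.const b)))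
  have hϑc := hϑ.uniformContinuousOn hϑb'
  have hcc : ∀ r : ℝ, UniformContinuousOn (fun _ : ℝ => r) (Set.Ici 0) := fun r =>
    uniformContinuous_const.uniformContinuousOn
  have hfun : chainOutput F b c lam (fun t => ∑ i, ϑ t i • z t i) (fun t => f t ⬝ᵥ ϑ t) j =
      fun t => ϑ t ⬝ᵥ fun i => chainOutput F b c lam (fun t => z t i) (fun t => f t i) j t :=
    funext fun t => chainOutput_combination c lam j t
  rw [hfun]
  refine uniformContinuousOn_dotProduct hϑb (boundedSignal_pi.2 fun i =>
    boundedSignal_chainOutput F b c lam (boundedSignal_pi.1 hzb i) (boundedSignal_pi.1 hfb i) j)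
    (uniformContinuousOn_apply hϑc) fun i => ?_
  have h1 := uniformContinuousOn_dotProduct (BoundedSignal.const (shiftedRow F c lam (j + 1)))
    (boundedSignal_pi.1 hzb i) (fun _ => hcc _) (uniformContinuousOn_apply (hzc i))
  have h2 := (BoundedSignal.const (shiftedRow F c lam j ⬝ᵥ b)).mul_uniformContinuousOn
    (boundedSignal_pi.1 hfb i) (hcc _) (uniformContinuousOn_apply hfc i)
  rw [uniformContinuousOn_iff_restrict] at h1 h2 ⊢
  exact h1.add h2

/-- If the output of a minimum phase filter, combined with slowly varying coefficients, tends to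
zero, then so does the combination of its inputs. -/
theorem tendsto_input_zero (hF : HurwitzMatrix F) (hH : transferFn F b c 0 ≠ 0)
    (hmp : MinimumPhase (transferFn F b c 0)) (hlam : 0 < lam)
    (h0 : ∀ i < ρ, shiftedRow F c lam i ⬝ᵥ b = 0) (hκ : shiftedRow F c lam ρ ⬝ᵥ b ≠ 0)
    (hz : ∀ i, DerivOnIci (fun t => z t i) fun t => F *ᵥ z t i + f t i • b)
    (hzb : BoundedSignal z) (hfb : BoundedSignal f) (hfc : UniformContinuousOn f (Set.Ici 0))
    (hϑ : DerivOnIci ϑ ϑ') (hϑb : BoundedSignal ϑ) (hϑb' : BoundedSignal ϑ')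
    (hϑ' : Tendsto ϑ' atTop (𝓝 0))
    (hout : Tendsto (chainOutput F b c lam (fun t => ∑ i, ϑ t i • z t i)
      (fun t => f t ⬝ᵥ ϑ t) 0) atTop (𝓝 0)) :
    Tendsto (fun t => f t ⬝ᵥ ϑ t) atTop (𝓝 0) := by
  have hZ := derivOnIci_combination hz hϑ
  set Z := fun t => ∑ i, ϑ t i • z t i with hZdef
  set u := fun t => f t ⬝ᵥ ϑ t with hu
  set d := fun t => ∑ i, ϑ' t i • z t i with hd
  have hd0 : Tendsto d atTop (𝓝 0) := by
    have h1 : ∀ i, Tendsto (fun t => ϑ' t i • z t i) atTop (𝓝 0) := fun i => by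
      rw [tendsto_pi_nhds]
      intro j
      have := (boundedSignal_pi.1 (boundedSignal_pi.1 hzb i) j).mul_tendsto_zero
        ((tendsto_pi_nhds.1 hϑ') i)
      simpa only [Pi.smul_apply, smul_eq_mul, mul_comm, Pi.zero_apply] using this
    simpa using tendsto_finsetSum Finset.univ fun i _ => h1 i
  have hdot : ∀ (a : Fin n → ℝ) {v : ℝ → Fin n → ℝ}, Tendsto v atTop (𝓝 0) →
      Tendsto (fun t => a ⬝ᵥ v t) atTop (𝓝 0) := fun a v hv => by
    simpa [dotProduct] using tendsto_finsetSum Finset.univ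
      fun i _ => ((tendsto_pi_nhds.1 hv) i).const_mul (a i)
  -- Barbalat's lemma climbs the chain: if output j vanishes asymptotically, its derivative differs
  -- from output j + 1 only by vanishing terms.
  have hY : ∀ j ≤ ρ, Tendsto (chainOutput F b c lam Z u j) atTop (𝓝 0) := by
    intro j
    induction j with
    | zero => exact fun _ => hout
    | succ j ih =>
      intro hj
      have hj0 := ih (by omega)
      refine tendsto_zero_of_derivOnIci (derivOnIci_chainOutput F b c lam hZ (h0 j (by omega)))
        hj0 (uniformContinuousOn_chainOutput c lam hz hzb hfb hfc hϑ hϑb hϑb' (j + 1)) ?_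
      have h2 := (hdot (shiftedRow F c lam (j + 1)) hd0).sub (hj0.const_mul lam)
      rw [mul_zero, sub_zero] at h2
      refine h2.congr fun t => ?_
      ring
  have hZ0 : Tendsto Z atTop (𝓝 0) := by
    refine (hurwitzMatrix_inverse F b c lam hF hH hmp hlam h0 hκ).tendsto_zero
      (derivOnIci_inverse F b c lam hZ hκ) ?_
    have h3 : Tendsto (fun t => ((shiftedRow F c lam ρ ⬝ᵥ b)⁻¹ *
        chainOutput F b c lam Z u ρ t) • b) atTop (𝓝 0) := by
      simpa using ((hY ρ le_rfl).const_mul (shiftedRow F c lam ρ ⬝ᵥ b)⁻¹).smul_const b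
    simpa using h3.add hd0
  have h4 := ((hY ρ le_rfl).sub (hdot (shiftedRow F c lam (ρ + 1)) hZ0)).const_mul
    (shiftedRow F c lam ρ ⬝ᵥ b)⁻¹
  rw [sub_zero, mul_zero] at h4
  exact h4.congr fun t => (input_eq F b c lam hκ t).symm

end Combination

/-! ### Boundedness of the inverse filter and smoothness of the tuner. -/

section Feedback

variable {n : ℕ} {F : Matrix (Fin n) (Fin n) ℝ} {b : Fin n → ℝ} (c : Fin n → ℝ) (lam : ℝ)
  {z : ℝ → Fin n → ℝ} {u : ℝ → ℝ} {ρ : ℕ}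

/-- The inverse of a minimum phase filter of relative degree `ρ` maps signals with `ρ` bounded
derivatives to bounded signals. -/
theorem boundedSignal_inverse (hF : HurwitzMatrix F) (hH : transferFn F b c 0 ≠ 0)
    (hmp : MinimumPhase (transferFn F b c 0)) (hlam : 0 < lam)
    (h0 : ∀ i < ρ, shiftedRow F c lam i ⬝ᵥ b = 0) (hκ : shiftedRow F c lam ρ ⬝ᵥ b ≠ 0)
    (hz : DerivOnIci z fun t => F *ᵥ z t + u t • b)
    (hv : SmoothBounded ρ (chainOutput F b c lam z u 0)) :
    BoundedSignal u ∧ BoundedSignal z := by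
  have hY : BoundedSignal (chainOutput F b c lam z u ρ) :=
    smoothBounded_chainOutput_of_output F b c lam hz h0 hv 0 ρ rfl
  have hzb : BoundedSignal z := by
    refine (hurwitzMatrix_inverse F b c lam hF hH hmp hlam h0 hκ).boundedSignal
      (derivOnIci_inverse F b c lam (d := fun _ => 0)
        (hz.congr_deriv fun t _ => (add_zero _).symm) hκ) ?_
    exact (((BoundedSignal.const _).mul hY).smul (BoundedSignal.const b)).add
      (BoundedSignal.const 0)
  refine ⟨?_, hzb⟩
  exact ((BoundedSignal.const _).mul (hY.sub ((BoundedSignal.const _).dotProduct hzb))).congr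
    fun t _ => input_eq F b c lam hκ t

/-- The smoothness of the regressor is inherited by the tuner. -/
theorem tuner_smoothBounded {m q : ℕ} {Γ : Matrix (Fin q) (Fin q) ℝ} {l p : Fin q → ℝ} {μ : ℝ}
    {θ : Fin m → ℝ} {e ε : ℝ → ℝ} {ϖ ψ : ℝ → Fin m → ℝ} {η : ℝ → Fin m → Fin q → ℝ}
    (he : DerivOnIci e fun t =>
      -lam * e t + ϖ t ⬝ᵥ (θ - (ψ t + fun i => l ⬝ᵥ η t i)) + ε t)
    (hψ : DerivOnIci ψ fun t => e t • ϖ t)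
    (hη : ∀ i, DerivOnIci (fun t => η t i) fun t =>
      (1 + μ * (ϖ t ⬝ᵥ ϖ t)) • (Γ *ᵥ η t i) + (ϖ t i * e t) • p)
    (heb : BoundedSignal e) (hψb : BoundedSignal ψ) (hηb : BoundedSignal η)
    (hε : ∀ k, SmoothBounded k ε) (hϖ : ∀ i, SmoothBounded ρ fun t => ϖ t i) (k : ℕ)
    (hk : k ≤ ρ) :
    SmoothBounded k e ∧ (∀ i, SmoothBounded k fun t => ψ t i) ∧
      ∀ i j, SmoothBounded k fun t => η t i j := by
  induction k with
  | zero =>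
    exact ⟨heb, boundedSignal_pi.1 hψb, fun i => boundedSignal_pi.1 (boundedSignal_pi.1 hηb i)⟩
  | succ k ih =>
    obtain ⟨ihe, ihψ, ihη⟩ := ih (by omega)
    have hϖk : ∀ i, SmoothBounded k fun t => ϖ t i := fun i => (hϖ i).mono (by omega)
    refine ⟨⟨heb, _, he, ?_⟩, fun i => ⟨boundedSignal_pi.1 hψb i, _, derivOnIci_pi.1 hψ i,
      ihe.mul (hϖk i)⟩, fun i j => ⟨boundedSignal_pi.1 (boundedSignal_pi.1 hηb i) j, _,
      derivOnIci_pi.1 (hη i) j, ?_⟩⟩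
    · refine ((ihe.const_mul (-lam)).add (SmoothBounded.sum fun i _ => (hϖk i).mul ?_)).add (hε k)
      exact (SmoothBounded.const k (θ i)).sub ((ihψ i).add
        (SmoothBounded.sum fun j _ => (ihη i j).const_mul (l j)))
    · have h1 : SmoothBounded k fun t => 1 + μ * (ϖ t ⬝ᵥ ϖ t) := (SmoothBounded.const k 1).add
        (SmoothBounded.const_mul μ (SmoothBounded.sum fun i _ => (hϖk i).mul (hϖk i)))
      exact (h1.mul (SmoothBounded.sum (s := Finset.univ) fun j' _ => (ihη i j').const_mul (Γ j j'))).add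
        (((hϖk i).mul ihe).mul (SmoothBounded.const k (p j)))

end Feedback

/-! ### Reduction of the closed loop to the error model. -/

section ClosedLoop

variable {n m r q : ℕ} {S : Plant n m} {k : Fin n → ℝ} {lam : ℝ} {D : Tuner q}
  {θ : Fin m → ℝ} {s : Signals n m q}

theorem errorMatrix_mulVec (S : Plant n m) (k v : Fin n → ℝ) :
    S.errorMatrix k *ᵥ v = S.A *ᵥ v - (S.c ⬝ᵥ v) • k := by
  rw [Plant.errorMatrix, Matrix.sub_mulVec, Matrix.vecMulVec_mulVec, op_smul_eq_smul]

theorem IsClosedLoop.derivOnIci_zφ (hs : IsClosedLoop S k lam r D θ s) (i : Fin m) :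
    DerivOnIci (fun t => s.zφ t i) fun t =>
      S.errorMatrix k *ᵥ s.zφ t i + S.φ (S.c ⬝ᵥ s.x t) i • S.b :=
  (hs.regressor i).state

theorem IsClosedLoop.ϖ_eq (hs : IsClosedLoop S k lam r D θ s) (i : Fin m) {t : ℝ} (ht : 0 ≤ t) :
    s.ϖ t i = chainOutput (S.errorMatrix k) S.b S.c lam (fun t => s.zφ t i)
      (fun t => S.φ (S.c ⬝ᵥ s.x t) i) 0 t :=
  (hs.regressor i).output t ht

theorem IsClosedLoop.ϖ_dotProduct_eq (hs : IsClosedLoop S k lam r D θ s) (ϑ : ℝ → Fin m → ℝ)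
    {t : ℝ} (ht : 0 ≤ t) :
    s.ϖ t ⬝ᵥ ϑ t = chainOutput (S.errorMatrix k) S.b S.c lam (fun t => ∑ i, ϑ t i • s.zφ t i)
      (fun t => S.φ (S.c ⬝ᵥ s.x t) ⬝ᵥ ϑ t) 0 t := by
  rw [chainOutput_combination (f := fun t => S.φ (S.c ⬝ᵥ s.x t)), dotProduct_comm]
  exact Finset.sum_congr rfl fun i _ => by rw [hs.ϖ_eq i ht]

theorem IsClosedLoop.feedback_eq (hs : IsClosedLoop S k lam r D θ s) {t : ℝ} (ht : 0 ≤ t) :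
    s.ϖ t ⬝ᵥ s.θhat t = chainOutput (S.errorMatrix k) S.b S.c lam s.zν s.ν 0 t :=
  hs.feedback.output t ht

/-- The error equation: up to a decaying term, the output error is
`(p + lam)⁻¹ [ϖᵀ (θ - θhat)]`. -/
theorem IsClosedLoop.error_dynamics (hs : IsClosedLoop S k lam r D θ s) :
    ∃ δ : ℝ → Fin n → ℝ, DerivOnIci δ (fun t => S.errorMatrix k *ᵥ δ t) ∧
      (∀ t, s.xhat t = s.x t - (δ t + ((∑ i, θ i • s.zφ t i) - s.zν t))) ∧
      DerivOnIci (fun t => S.c ⬝ᵥ s.x t - S.c ⬝ᵥ s.xhat t) fun t =>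
        -lam * (S.c ⬝ᵥ s.x t - S.c ⬝ᵥ s.xhat t) + s.ϖ t ⬝ᵥ (θ - s.θhat t) +
          shiftedRow (S.errorMatrix k) S.c lam 1 ⬝ᵥ δ t := by
  have hz : DerivOnIci (fun t => (∑ i, θ i • s.zφ t i) - s.zν t) fun t =>
      S.errorMatrix k *ᵥ ((∑ i, θ i • s.zφ t i) - s.zν t) +
        (S.φ (S.c ⬝ᵥ s.x t) ⬝ᵥ θ - s.ν t) • S.b := by
    refine ((derivOnIci_combination (f := fun t => S.φ (S.c ⬝ᵥ s.x t)) hs.derivOnIci_zφ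
      (DerivOnIci.const θ)).sub hs.feedback.state).congr_deriv fun t _ => ?_
    rw [Matrix.mulVec_sub, sub_smul]
    simp only [Pi.zero_apply, zero_smul, Finset.sum_const_zero]
    abel
  have hx : DerivOnIci (fun t => s.x t - s.xhat t) fun t =>
      S.errorMatrix k *ᵥ (s.x t - s.xhat t) + (S.φ (S.c ⬝ᵥ s.x t) ⬝ᵥ θ - s.ν t) • S.b := by
    refine (DerivOnIci.sub hs.master hs.observer).congr_deriv fun t _ => ?_
    rw [errorMatrix_mulVec, Matrix.mulVec_sub, dotProduct_sub, sub_smul _ _ S.b]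
    abel
  -- The observer error and the filter states obey the same equation with the same input, so their
  -- difference is autonomous.
  refine ⟨fun t => (s.x t - s.xhat t) - ((∑ i, θ i • s.zφ t i) - s.zν t),
    (hx.sub hz).congr_deriv fun t _ => ?_, fun t => by rw [sub_add_cancel, sub_sub_cancel], ?_⟩
  · rw [Matrix.mulVec_sub _ (s.x t - s.xhat t)]
    abel
  · refine ((hx.dotProduct S.c).congr fun t _ => (dotProduct_sub _ _ _).symm).congr_deriv
      fun t ht => ?_
    have h1 := hs.ϖ_dotProduct_eq (fun _ => θ) ht
    have h2 := hs.feedback_eq ht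
    simp only [chainOutput, shiftedRow, add_dotProduct, smul_dotProduct, Matrix.mulVec_transpose,
      ← Matrix.dotProduct_mulVec, smul_eq_mul] at h1 h2
    simp only [shiftedRow, add_dotProduct, smul_dotProduct, Matrix.mulVec_transpose,
      ← Matrix.dotProduct_mulVec, smul_eq_mul, dotProduct_sub, dotProduct_add, dotProduct_smul,
      Matrix.mulVec_sub, h1, h2]
    ring

/-- For frozen ψᵢ the filter has equilibrium -ψᵢΓ⁻¹h. The deviation from it is damped by Γ and
forced only through the derivative of ψᵢ. -/
theorem IsClosedLoop.derivOnIci_η_shift (hs : IsClosedLoop S k lam r D θ s)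
    (hdet : IsUnit D.Γ.det) (i : Fin m) :
    DerivOnIci (fun t => s.η t i + s.ψ t i • (D.Γ⁻¹ *ᵥ D.h)) fun t =>
      (1 + D.μ * (s.ϖ t ⬝ᵥ s.ϖ t)) • (D.Γ *ᵥ (s.η t i + s.ψ t i • (D.Γ⁻¹ *ᵥ D.h))) +
        (s.ϖ t i * (S.c ⬝ᵥ s.x t - S.c ⬝ᵥ s.xhat t)) • (D.Γ⁻¹ *ᵥ D.h) := by
  refine (DerivOnIci.add (hs.eta i) ((derivOnIci_pi.1 hs.psi i).smul
    (DerivOnIci.const (D.Γ⁻¹ *ᵥ D.h)))).congr_deriv fun t _ => ?_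
  rw [Matrix.mulVec_add, Matrix.mulVec_smul, Matrix.mulVec_mulVec,
    Matrix.mul_nonsing_inv _ hdet, Matrix.one_mulVec, smul_zero, zero_add, Pi.smul_apply,
    smul_eq_mul, mul_comm (s.ϖ t i)]

/-- For r ≥ 3 the static gain -1 turns the shift into +ψ. For r ≤ 2 the truncated difference r - 2
makes q = 0, and the correction is an empty sum. -/
theorem IsClosedLoop.θhat_eq (hs : IsClosedLoop S k lam r D θ s) (hq : q = r - 2)
    (hgain : 3 ≤ r → D.l ⬝ᵥ (D.Γ⁻¹ *ᵥ D.h) = -1) {t : ℝ} (ht : 0 ≤ t) :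
    s.θhat t = s.ψ t + fun i => D.l ⬝ᵥ (s.η t i + s.ψ t i • (D.Γ⁻¹ *ᵥ D.h)) := by
  ext i
  rw [hs.estimate t ht i, Pi.add_apply]
  split_ifs with hr
  · have hq0 : q = 0 := by omega
    subst hq0
    simp [dotProduct]
  · rw [dotProduct_add, dotProduct_smul, hgain (by omega), smul_eq_mul]
    ring

end ClosedLoop

/-! ### Regularity of the master system and regressor signals. -/

section Signals

variable {n m r q : ℕ} {S : Plant n m} {k : Fin n → ℝ} {lam : ℝ} {D : Tuner q}
  {θ : Fin m → ℝ} {s : Signals n m q}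

theorem boundedSignal_comp {E : Type*} [NormedAddCommGroup E] {g : ℝ → E} {y : ℝ → ℝ}
    (hg : ∀ t : Set ℝ, Bornology.IsBounded t → Bornology.IsBounded (g '' t))
    (hy : BoundedSignal y) : BoundedSignal fun t => g (y t) := by
  obtain ⟨C, hC⟩ := hy
  obtain ⟨K, hK⟩ := (hg _ (Metric.isBounded_closedBall (x := (0 : ℝ)) (r := C))).exists_norm_le
  exact ⟨K, fun t ht => hK _ ⟨y t, by simpa using hC t ht, rfl⟩⟩

theorem uniformContinuousOn_comp {E : Type*} [NormedAddCommGroup E] {g : ℝ → E} {y : ℝ → ℝ}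
    (hg : Continuous g) (hy : BoundedSignal y) (hyc : UniformContinuousOn y (Set.Ici 0)) :
    UniformContinuousOn (fun t => g (y t)) (Set.Ici 0) := by
  obtain ⟨C, hC⟩ := hy
  have h1 := (isCompact_closedBall (0 : ℝ) C).uniformContinuousOn_of_continuous hg.continuousOn
  exact h1.comp hyc fun t ht => by simpa using hC t ht

/-- The signals of the master system and of the regressor filters are bounded. -/
theorem IsClosedLoop.boundedSignal_regressor (hs : IsClosedLoop S k lam r D θ s)
    (hbdd : S.BoundedTrajectories) (hloc : S.LocallyBoundedNonlinearities)
    (hF : HurwitzMatrix (S.errorMatrix k)) :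
    BoundedSignal s.x ∧ BoundedSignal (fun t => S.c ⬝ᵥ s.x t) ∧
      BoundedSignal (fun t => S.φ₀ (S.c ⬝ᵥ s.x t)) ∧
      BoundedSignal (fun t => S.φ (S.c ⬝ᵥ s.x t)) ∧ BoundedSignal s.zφ ∧ BoundedSignal s.ϖ := by
  have hx := hbdd θ s.x hs.master
  have hy : BoundedSignal fun t => S.c ⬝ᵥ s.x t := (BoundedSignal.const S.c).dotProduct hx
  have hφ := boundedSignal_comp (fun t ht => (hloc t ht).2) hy
  have hz : BoundedSignal s.zφ := boundedSignal_pi.2 fun i =>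
    hF.boundedSignal (hs.derivOnIci_zφ i)
      ((boundedSignal_pi.1 hφ i).smul (BoundedSignal.const S.b))
  refine ⟨hx, hy, boundedSignal_comp (fun t ht => (hloc t ht).1) hy, hφ, hz,
    boundedSignal_pi.2 fun i => ?_⟩
  exact (boundedSignal_chainOutput _ _ _ _ (boundedSignal_pi.1 hz i)
    (boundedSignal_pi.1 hφ i) 0).congr fun t ht => hs.ϖ_eq i ht

/-- The nonlinearity `φ(y(t))` is uniformly continuous along trajectories. -/
theorem IsClosedLoop.uniformContinuousOn_φ (hs : IsClosedLoop S k lam r D θ s)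
    (hcont : Continuous S.φ) (hx : BoundedSignal s.x)
    (hφ₀ : BoundedSignal (fun t => S.φ₀ (S.c ⬝ᵥ s.x t)))
    (hφ : BoundedSignal (fun t => S.φ (S.c ⬝ᵥ s.x t))) :
    UniformContinuousOn (fun t => S.φ (S.c ⬝ᵥ s.x t)) (Set.Ici 0) := by
  have hy : BoundedSignal fun t => S.c ⬝ᵥ s.x t := (BoundedSignal.const S.c).dotProduct hx
  refine uniformContinuousOn_comp hcont hy ?_
  have h1 : DerivOnIci s.x _ := hs.master
  exact (h1.dotProduct S.c).uniformContinuousOn ((BoundedSignal.const S.c).dotProduct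
    (((hx.mulVec S.A).add hφ₀).add ((hφ.dotProduct (BoundedSignal.const θ)).smul
      (BoundedSignal.const S.b))))

end Signals

end HOT

/-! ### Assembly of the theorem. -/

open HOT

theorem theorem2 {n m r q : ℕ} (S : HOT.Plant n m) (k : Fin n → ℝ) (lam : ℝ) (D : HOT.Tuner q)
    (α : Polynomial ℝ) (P : Matrix (Fin q) (Fin q) ℝ)
    (hbdd : S.BoundedTrajectories)
    (hloc : S.LocallyBoundedNonlinearities)
    (hcont : Continuous S.φ)
    (hF : HOT.HurwitzMatrix (S.errorMatrix k))
    (hr : HOT.HasRelativeDegree (S.H k) r)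
    (hlam : 0 < lam)
    -- `(l, Γ, h)` is a minimal realization (of dimension `deg α = r - 2`) of `α(0)/α(p)`;
    -- for `r ≤ 2` there is no such filter
    (hq : q = r - 2)
    (hα : HOT.HurwitzPoly α) (hαdeg : α.natDegree = q)
    (hreal : 3 ≤ r → HOT.transferFn D.Γ D.h D.l 0 =
      RatFunc.C (α.eval 0) / algebraMap (Polynomial ℝ) (RatFunc ℝ) α)
    (hP : P.PosDef) (hLyap : D.Γᵀ * P + P * D.Γ = -(2 : ℝ) • (1 : Matrix (Fin q) (Fin q) ℝ))
    (hμ : D.μ > 3 / (4 * lam) *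
      (‖WithLp.toLp 2 D.l‖ + ‖WithLp.toLp 2 ((P * D.Γ⁻¹) *ᵥ D.h)‖) ^ 2)
    (θ : Fin m → ℝ) (s : HOT.Signals n m q) (hs : HOT.IsClosedLoop S k lam r D θ s) :
    -- (i)
    (HOT.BoundedSignal s.x ∧
      HOT.BoundedSignal (fun t => S.c ⬝ᵥ s.x t) ∧
      HOT.BoundedSignal (fun t => S.φ₀ (S.c ⬝ᵥ s.x t)) ∧
      HOT.BoundedSignal (fun t => S.φ (S.c ⬝ᵥ s.x t)) ∧
      HOT.BoundedSignal (fun t => S.c ⬝ᵥ s.xhat t) ∧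
      HOT.BoundedSignal s.zφ ∧ HOT.BoundedSignal s.ϖ ∧
      HOT.BoundedSignal s.ψ ∧ HOT.BoundedSignal s.η ∧ HOT.BoundedSignal s.θhat ∧
      (HOT.MinimumPhase (S.H k) →
        HOT.BoundedSignal s.ν ∧ HOT.BoundedSignal s.zν ∧ HOT.BoundedSignal s.xhat) ∧
      Tendsto (fun t => S.c ⬝ᵥ s.x t - S.c ⬝ᵥ s.xhat t) atTop (𝓝 0)) ∧
    -- (ii)
    (HOT.PersistentlyExciting (fun t => S.φ (S.c ⬝ᵥ s.x t)) → HOT.MinimumPhase (S.H k) →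
      Tendsto (fun t => ‖WithLp.toLp 2 (θ - s.θhat t)‖) atTop (𝓝 0)) := by
  have hsym : Pᵀ = P := by simpa using hP.isHermitian.eq
  have hdet := isUnit_det_of_lyapunov hsym hLyap
  have hgain : 3 ≤ r → D.l ⬝ᵥ (D.Γ⁻¹ *ᵥ D.h) = -1 := fun h3 =>
    static_gain D.Γ D.h D.l hα hdet (hreal h3)
  obtain ⟨ρ, -, h0, hκ⟩ := hr.shiftedRow (S.errorMatrix k) S.b S.c lam
  obtain ⟨hx, hy, hφ₀, hφ, hzφ, hϖ⟩ := hs.boundedSignal_regressor hbdd hloc hF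
  have hφc := hs.uniformContinuousOn_φ hcont hx hφ₀ hφ
  obtain ⟨δ, hδ, hxhat, he⟩ := hs.error_dynamics
  have hδb : BoundedSignal δ := hF.boundedSignal (f := fun _ => 0)
    (hδ.congr_deriv fun t _ => (add_zero _).symm) (BoundedSignal.const 0)
  have hε := hF.dissipated hδ (shiftedRow (S.errorMatrix k) S.c lam 1)
  have hεs := fun j => smoothBounded_of_linear hδ hδb j (shiftedRow (S.errorMatrix k) S.c lam 1)
  have hε0 : Tendsto (fun t => shiftedRow (S.errorMatrix k) S.c lam 1 ⬝ᵥ δ t) atTop (𝓝 0) :=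
    hε.tendsto_zero ((hδ.dotProduct _).uniformContinuousOn
      ((BoundedSignal.const _).dotProduct (hδb.mulVec _)))
  set e := fun t => S.c ⬝ᵥ s.x t - S.c ⬝ᵥ s.xhat t with hedef
  have hη := hs.derivOnIci_η_shift hdet
  set η : ℝ → Fin m → Fin q → ℝ := fun t i => s.η t i + s.ψ t i • (D.Γ⁻¹ *ᵥ D.h) with hηdef
  have hθ : ∀ t, 0 ≤ t → s.θhat t = s.ψ t + fun i => D.l ⬝ᵥ η t i := fun t ht =>
    hs.θhat_eq hq hgain ht
  -- In the shifted variables the loop is the error model of `tuner_stability` with p = Γ⁻¹h.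
  have he' := he.congr_deriv fun t ht => by rw [hθ t ht]
  rw [← Matrix.mulVec_mulVec] at hμ
  have hψ : DerivOnIci s.ψ fun t => e t • s.ϖ t := hs.psi
  obtain ⟨heb, hψb, hηb, hed, hηd⟩ := tuner_stability hP hLyap hlam hμ he' hψ hη hε
  have hθb : BoundedSignal s.θhat := (hψb.add (boundedSignal_pi.2 fun i =>
    (BoundedSignal.const D.l).dotProduct (boundedSignal_pi.1 hηb i))).congr hθ
  have heb' : BoundedSignal fun t => -lam * e t + s.ϖ t ⬝ᵥ (θ - s.θhat t) +
      shiftedRow (S.errorMatrix k) S.c lam 1 ⬝ᵥ δ t :=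
    (((BoundedSignal.const _).mul heb).add
      (hϖ.dotProduct ((BoundedSignal.const θ).sub hθb))).add
      ((BoundedSignal.const _).dotProduct hδb)
  have he0 : Tendsto e atTop (𝓝 0) := hed.tendsto_zero (he.uniformContinuousOn heb')
  refine ⟨⟨hx, hy, hφ₀, hφ, (hy.sub heb).congr fun t _ => by simp [hedef], hzφ, hϖ, hψb,
    ?_, hθb, fun hmp => ?_, he0⟩, fun hPE hmp => ?_⟩
  · refine boundedSignal_pi.2 fun i => ?_
    exact ((boundedSignal_pi.1 hηb i).sub ((boundedSignal_pi.1 hψb i).smul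
      (BoundedSignal.const (D.Γ⁻¹ *ᵥ D.h)))).congr fun t _ => by simp [hηdef]
  · have hϖs : ∀ i, SmoothBounded ρ fun t => s.ϖ t i := fun i =>
      (smoothBounded_chainOutput _ _ _ _ (hs.derivOnIci_zφ i) h0 (boundedSignal_pi.1 hzφ i)
        (boundedSignal_pi.1 hφ i) ρ 0 (zero_add ρ)).congr fun t ht => hs.ϖ_eq i ht
    obtain ⟨-, hψs, hηs⟩ := tuner_smoothBounded lam he' hψ hη heb hψb hηb hεs hϖs ρ le_rfl
    have hv : SmoothBounded ρ
        (chainOutput (S.errorMatrix k) S.b S.c lam s.zν s.ν 0) := by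
      have h1 : SmoothBounded ρ fun t => s.ϖ t ⬝ᵥ (s.ψ t + fun i => D.l ⬝ᵥ η t i) :=
        SmoothBounded.sum fun i _ => (hϖs i).mul ((hψs i).add
          (SmoothBounded.sum fun j _ => (hηs i j).const_mul (D.l j)))
      exact h1.congr fun t ht => by rw [← hs.feedback_eq ht, hθ t ht]
    obtain ⟨hν, hzν⟩ := boundedSignal_inverse S.c lam hF hr.1 hmp hlam h0 hκ
      hs.feedback.state hv
    refine ⟨hν, hzν, (hx.sub (hδb.add (BoundedSignal.sub (BoundedSignal.sum fun i _ =>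
      (BoundedSignal.const (θ i)).smul (boundedSignal_pi.1 hzφ i)) hzν))).congr
      fun t _ => hxhat t⟩
  · have hη0 : ∀ i j, Tendsto (fun t => η t i j) atTop (𝓝 0) := fun i j => by
      have h1 : BoundedSignal fun t => (1 + D.μ * (s.ϖ t ⬝ᵥ s.ϖ t)) • (D.Γ *ᵥ η t i) +
          (s.ϖ t i * e t) • (D.Γ⁻¹ *ᵥ D.h) :=
        (((BoundedSignal.const 1).add ((BoundedSignal.const D.μ).mul
          (hϖ.dotProduct hϖ))).smul ((boundedSignal_pi.1 hηb i).mulVec _)).add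
          (((boundedSignal_pi.1 hϖ i).mul heb).smul (BoundedSignal.const _))
      exact (hηd i j).tendsto_zero
        ((derivOnIci_pi.1 (hη i) j).uniformContinuousOn (boundedSignal_pi.1 h1 j))
    have hlη0 : Tendsto (fun t i => D.l ⬝ᵥ η t i) atTop (𝓝 (0 : Fin m → ℝ)) := by
      rw [tendsto_pi_nhds]
      intro i
      simpa [dotProduct] using tendsto_finsetSum Finset.univ
        fun j _ => (hη0 i j).const_mul (D.l j)
    set ϑ := fun t => θ - s.ψ t with hϑdef
    have hϑ : DerivOnIci ϑ fun t => 0 - e t • s.ϖ t := (DerivOnIci.const θ).sub hψ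
    have hϑb : BoundedSignal ϑ := (BoundedSignal.const θ).sub hψb
    have hϑb' : BoundedSignal fun t => 0 - e t • s.ϖ t :=
      (BoundedSignal.const 0).sub (heb.smul hϖ)
    have hϑ0' : Tendsto (fun t => 0 - e t • s.ϖ t) atTop (𝓝 0) := by
      rw [tendsto_pi_nhds]
      intro i
      simpa [mul_comm] using ((boundedSignal_pi.1 hϖ i).mul_tendsto_zero he0).neg
    -- This chain output is ϖᵀϑ. Since e → 0 and e' differs from ϖᵀϑ only by -λe, ϖᵀlᵀη̃ and ε, all
    -- vanishing, Barbalat's lemma applies.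
    have hout : Tendsto (chainOutput (S.errorMatrix k) S.b S.c lam
        (fun t => ∑ i, ϑ t i • s.zφ t i) (fun t => S.φ (S.c ⬝ᵥ s.x t) ⬝ᵥ ϑ t) 0) atTop (𝓝 0) := by
      refine tendsto_zero_of_derivOnIci he he0 (uniformContinuousOn_chainOutput
        (f := fun t => S.φ (S.c ⬝ᵥ s.x t)) S.c lam hs.derivOnIci_zφ hzφ hφ hφc hϑ hϑb hϑb' 0) ?_
      have h1 : Tendsto (fun t => s.ϖ t ⬝ᵥ fun i => D.l ⬝ᵥ η t i) atTop (𝓝 0) := by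
        simpa [dotProduct] using tendsto_finsetSum Finset.univ fun i _ =>
          (boundedSignal_pi.1 hϖ i).mul_tendsto_zero ((tendsto_pi_nhds.1 hlη0) i)
      have h2 := ((he0.const_mul (-lam)).sub h1).add hε0
      rw [mul_zero, sub_zero, add_zero] at h2
      refine h2.congr' ?_
      filter_upwards [eventually_ge_atTop 0] with t ht
      rw [← hs.ϖ_dotProduct_eq ϑ ht, hθ t ht]
      simp only [hϑdef, dotProduct_sub, dotProduct_add]
      ring
    have hu := tendsto_input_zero (f := fun t => S.φ (S.c ⬝ᵥ s.x t)) S.c lam hF hr.1 hmp hlam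
      h0 hκ hs.derivOnIci_zφ hzφ hφ hφc hϑ hϑb hϑb' hϑ0' hout
    have hϑ0 : Tendsto ϑ atTop (𝓝 0) :=
      hPE.tendsto_zero hφc.continuousOn hϑ hϑ0' hu
    have h3 : Tendsto (fun t => θ - s.θhat t) atTop (𝓝 0) := by
      have h4 := hϑ0.sub hlη0
      rw [sub_zero] at h4
      refine h4.congr' ?_
      filter_upwards [eventually_ge_atTop 0] with t ht
      rw [hθ t ht, hϑdef, sub_sub]
    have h5 := ((PiLp.continuous_toLp 2 fun _ : Fin m => ℝ).tendsto 0).comp h3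
    simpa using h5.norm
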